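/- Let $\Omega\subset\mathbb{R}^2$ be a bounded domain (a nonempty, connected, bounded open set); no regularity of its boundary is assumed. All norms are $L^2(\Omega)$ norms, $H^1_0(\Omega)$ is the closure of $C_0^\infty(\Omega)$ in $H^1(\Omega)$, and $|\boldsymbol{u}|_1^2=\sum_{k,j=1}^2\|\partial_{x_j}u_k\|^2$ for $\boldsymbol{u}=(u_1,u_2)\in H^1_0(\Omega)^2$. The Babuška–Aziz constant $C(\Omega)\in[0,\infty]$ is the smallest constant $C$ such that for every real-valued $q\in L^2(\Omega)$ with $\int_\Omega q\,dx=0$ there exists $\boldsymbol{u}\in H^1_0(\Omega)^2$ with $\operatorname{div}\boldsymbol{u}=q$ and $|\boldsymbol{u}|_1^2\le C\,\|q\|^2$; $C(\Omega)=\infty$ if there is no such constant. The Friedrichs constant $\Gamma(\Omega)\in[0,\infty]$ is the smallest constant $\Gamma$ such that $\|h\|^2\le\Gamma\,\|g\|^2$ for all holomorphic functions $h+ig$ on $\Omega$ ($h,g$ real-valued, $\mathbb{R}^2$ identified with $\mathbb{C}$) that are square integrable on $\Omega$ and satisfy $\int_\Omega (h+ig)\,dx=0$; $\Gamma(\Omega)=\infty$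 if there is no such constant. Then $C(\Omega)$ is finite if and only if $\Gamma(\Omega)$ is finite, and \[ C(\Omega)=\Gamma(\Omega)+1 . \] -/

import Mathlib

open MeasureTheory TopologicalSpace
open scoped ENNReal NNReal Distributions

noncomputable section

namespace PlaneDomain

/-- The two coordinate directions of the plane `ℝ²`, which is identified with `ℂ`. -/
def dir : Fin 2 → ℂ := ![1, Complex.I]

/-- The space `L²(Ω)` of real-valued square integrable functions. -/
abbrev L2 (Ω : Opens ℂ) : Type := Lp ℝ 2 (volume.restrict (Ω : Set ℂ))

/-- The Hilbert space of all `(u, (v₀, v₁))` with `u, v₀, v₁ ∈ L²(Ω)`, with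
`‖(u, v)‖² = ‖u‖² + ‖v₀‖² + ‖v₁‖²`. -/
abbrev Jet (Ω : Opens ℂ) : Type := WithLp 2 (L2 Ω × PiLp 2 (fun _ : Fin 2 => L2 Ω))

/-- `v` is the weak partial derivative `∂ⱼ u` in `Ω`. -/
def IsWeakPartial (Ω : Opens ℂ) (j : Fin 2) (u v : L2 Ω) : Prop :=
  ∀ φ : 𝓓(Ω, ℝ), ∫ x in (Ω : Set ℂ), u x * fderiv ℝ φ x (dir j) =
    -∫ x in (Ω : Set ℂ), v x * φ x

/-- The Sobolev space `H¹(Ω)`: a function `u ∈ L²(Ω)` all of whose weak partial derivatives are in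
`L²(Ω)` is recorded as the pair `(u, grad u)`, so that the norm of the ambient space is the
`H¹(Ω)` norm. -/
def H1 (Ω : Opens ℂ) : Set (Jet Ω) :=
  {U | ∀ j, IsWeakPartial Ω j U.fst (U.snd j)}

/-- The pairs `(φ, grad φ)` with `φ` smooth and compactly supported in `Ω`. -/
def testJets (Ω : Opens ℂ) : Set (Jet Ω) :=
  {U | ∃ φ : 𝓓(Ω, ℝ), (U.fst =ᵐ[volume.restrict (Ω : Set ℂ)] fun x => φ x) ∧
    ∀ j, U.snd j =ᵐ[volume.restrict (Ω : Set ℂ)] fun x => fderiv ℝ φ x (dir j)}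

/-- `H¹₀(Ω)`: the closure of `C₀^∞(Ω)` in `H¹(Ω)` for the `H¹(Ω)` norm. -/
def H10 (Ω : Opens ℂ) : Set (Jet Ω) :=
  {U | U ∈ H1 Ω ∧ U ∈ closure (testJets Ω)}

/-- The divergence `∂₀ u₀ + ∂₁ u₁` of a vector field `u = (u₀, u₁)`. -/
def div {Ω : Opens ℂ} (u : Fin 2 → Jet Ω) : L2 Ω := ∑ j, (u j).snd j

/-- The squared seminorm `|u|₁² = ∑ₖ ∑ⱼ ‖∂ⱼ uₖ‖²` of a vector field. -/
def seminormSq {Ω : Opens ℂ} (u : Fin 2 → Jet Ω) : ℝ := ∑ k, ∑ j, ‖(u k).snd j‖ ^ 2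

/-- The Babuška–Aziz inequality holds with the constant `C`: every `q ∈ L²(Ω)` of mean value zero
is the divergence of some `u ∈ H¹₀(Ω)²` with `|u|₁² ≤ C ‖q‖²`. -/
def BabuskaAzizWith (Ω : Opens ℂ) (C : ℝ≥0) : Prop :=
  ∀ q : L2 Ω, ∫ x in (Ω : Set ℂ), q x = 0 →
    ∃ u : Fin 2 → Jet Ω, (∀ k, u k ∈ H10 Ω) ∧ div u = q ∧ seminormSq u ≤ C * ‖q‖ ^ 2

/-- The Babuška–Aziz constant `C(Ω) ∈ [0, ∞]`, which is `∞` if no constant is admissible. -/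
def babuskaAzizConst (Ω : Opens ℂ) : ℝ≥0∞ :=
  ⨅ (C : ℝ≥0) (_ : BabuskaAzizWith Ω C), (C : ℝ≥0∞)

/-- The space of holomorphic functions on `Ω` that are square integrable on `Ω` and have
mean value zero. -/
def friedrichsSpace (Ω : Opens ℂ) : Set (ℂ → ℂ) :=
  {w | DifferentiableOn ℂ w Ω ∧ MemLp w 2 (volume.restrict (Ω : Set ℂ)) ∧
    ∫ x in (Ω : Set ℂ), w x = 0}

/-- The Friedrichs inequality holds with the constant `Γ`: `‖h‖² ≤ Γ ‖g‖²` for all `h + i g` in the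
above space, with `h`, `g` real-valued. -/
def FriedrichsWith (Ω : Opens ℂ) (Γ : ℝ≥0) : Prop :=
  ∀ w ∈ friedrichsSpace Ω,
    ∫ x in (Ω : Set ℂ), (w x).re ^ 2 ≤ Γ * ∫ x in (Ω : Set ℂ), (w x).im ^ 2

/-- The Friedrichs constant `Γ(Ω) ∈ [0, ∞]`, which is `∞` if no constant is admissible. -/
def friedrichsConst (Ω : Opens ℂ) : ℝ≥0∞ :=
  ⨅ (Γ : ℝ≥0) (_ : FriedrichsWith Ω Γ), (Γ : ℝ≥0∞)

end PlaneDomain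

end

/-! For fields in `H¹₀(Ω)²` the relation `⟪∂₀U, ∂₁V⟫ = ⟪∂₁U, ∂₀V⟫` turns the Dirichlet form into
`⟪div u, div v⟫ + ⟪rot u, rot v⟫` (`sum_inner_eq`). Moreover, `h + ig` is holomorphic exactly when
`⟪h, div u⟫ = ⟪g, rot u⟫` for all such `u`; going from this weak identity back to a holomorphic
function is Weyl's lemma, proved here with a smoothed Cauchy kernel.

`Γ ≤ C - 1`: take `u` with `div u = h`. Then `‖h‖² = ⟪g, rot u⟫ ≤ ‖g‖ ‖rot u‖`, and `‖rot u‖² ≤ (C -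
1) ‖h‖²`, so `‖h‖² ≤ (C - 1) ‖g‖²` (`IsConjugate.norm_sq_le`).

`C ≤ Γ + 1`: by duality (`exists_eq_of_dual_bound`) it suffices to show `‖p‖² ≤ (Γ + 1) |u|₁²` when
`p` has mean zero and `u` represents the functional `v ↦ ⟪p, div v⟫` for the Dirichlet form. In that
case `p - div u` and `rot u` are conjugate with mean zero, so the Friedrichs inequality applies to
them (`FriedrichsWith.norm_sq_le_seminormSq`). No step involves the boundary of `Ω`. -/

namespace PlaneDomain

open Complex Filter Topology Metric

/-! ### The Wirtinger operator -/

/-- Twice the Wirtinger derivative `∂f/∂z̄`. -/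
noncomputable def dbar (f : ℂ → ℂ) (z : ℂ) : ℂ := fderiv ℝ f z 1 + I * fderiv ℝ f z I

theorem dbar_congr {f g : ℂ → ℂ} {z : ℂ} (h : f =ᶠ[𝓝 z] g) : dbar f z = dbar g z := by
  simp only [dbar, h.fderiv_eq]

theorem dbar_sub {f g : ℂ → ℂ} {z : ℂ} (hf : DifferentiableAt ℝ f z)
    (hg : DifferentiableAt ℝ g z) :
    dbar (fun x => f x - g x) z = dbar f z - dbar g z := by
  simp only [dbar, fderiv_fun_sub hf hg, sub_apply]
  ring

theorem fderiv_comp_const_sub {F : Type*} [NormedAddCommGroup F] [NormedSpace ℝ F] {f : ℂ → F}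
    (hf : Differentiable ℝ f) (a z : ℂ) :
    fderiv ℝ (fun x => f (a - x)) z = -fderiv ℝ f (a - z) := by
  have h : HasFDerivAt (fun x : ℂ => a - x) (-ContinuousLinearMap.id ℝ ℂ) z :=
    (hasFDerivAt_id z).const_sub a
  have h2 := (hf (a - z)).hasFDerivAt.comp z h
  rw [show (fun x => f (a - x)) = f ∘ fun x => a - x from rfl, h2.fderiv]
  ext
  simp

theorem dbar_comp_const_sub {f : ℂ → ℂ} (hf : Differentiable ℝ f) (a z : ℂ) :
    dbar (fun x => f (a - x)) z = -dbar f (a - z) := by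
  simp only [dbar, fderiv_comp_const_sub hf, neg_apply]
  ring

theorem dbar_ofReal {φ : ℂ → ℝ} {z : ℂ} (h : DifferentiableAt ℝ φ z) :
    dbar (fun x => (φ x : ℂ)) z = fderiv ℝ φ z 1 + I * fderiv ℝ φ z I := by
  have : HasFDerivAt (fun x => (φ x : ℂ)) (ofRealCLM.comp (fderiv ℝ φ z)) z :=
    ofRealCLM.hasFDerivAt.comp z h.hasFDerivAt
  simp [dbar, this.fderiv]

theorem continuous_dbar {f : ℂ → ℂ} (hf : ContDiff ℝ 1 f) : Continuous (dbar f) := by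
  have := hf.continuous_fderiv one_ne_zero
  unfold dbar
  fun_prop

/-! ### The smoothed Cauchy kernel and its bump -/

/-- A smooth function on the line that rises from `0` to `1` in the interval `[1/2, 1]`. -/
noncomputable def profile (t : ℝ) : ℝ := Real.smoothTransition (2 * t - 1)

theorem contDiff_profile {n : ℕ∞} : ContDiff ℝ n profile :=
  Real.smoothTransition.contDiff.comp (by fun_prop)

theorem profile_of_le {t : ℝ} (h : t ≤ 1 / 2) : profile t = 0 :=
  Real.smoothTransition.zero_of_nonpos (by linarith)

theorem profile_of_ge {t : ℝ} (h : 1 ≤ t) : profile t = 1 :=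
  Real.smoothTransition.one_of_one_le (by linarith)

theorem profile_mono : Monotone profile := fun _ _ h =>
  Real.smoothTransition.monotone (by linarith)

theorem deriv_profile_nonneg (t : ℝ) : 0 ≤ deriv profile t := profile_mono.deriv_nonneg

theorem contDiff_deriv_profile {n : ℕ∞} : ContDiff ℝ n (deriv profile) := by
  have h : ContDiff ℝ ((n : WithTop ℕ∞) + 1) profile := by
    exact_mod_cast contDiff_profile (n := n + 1)
  exact ContDiff.deriv' h

theorem deriv_profile_of_lt {t : ℝ} (h : t < 1 / 2) : deriv profile t = 0 := by
  have : profile =ᶠ[𝓝 t] fun _ => 0 := by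
    filter_upwards [gt_mem_nhds h] with s hs using profile_of_le hs.le
  rw [this.deriv_eq, deriv_const]

theorem deriv_profile_of_gt {t : ℝ} (h : 1 < t) : deriv profile t = 0 := by
  have : profile =ᶠ[𝓝 t] fun _ => 1 := by
    filter_upwards [lt_mem_nhds h] with s hs using profile_of_ge hs.le
  rw [this.deriv_eq, deriv_const]

theorem exists_deriv_profile_le : ∃ M, ∀ t, deriv profile t ≤ M := by
  obtain ⟨M, hM⟩ := isCompact_Icc.exists_bound_of_continuousOn
    (s := Set.Icc (1 / 2 : ℝ) 1) (contDiff_deriv_profile (n := 0)).continuous.continuousOn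
  refine ⟨max M 0, fun t => ?_⟩
  by_cases h1 : t < 1 / 2
  · simp [deriv_profile_of_lt h1]
  by_cases h2 : 1 < t
  · simp [deriv_profile_of_gt h2]
  exact (le_abs_self _).trans ((hM t ⟨not_lt.1 h1, not_lt.1 h2⟩).trans (le_max_left _ _))

/-- The mean value theorem on `[0, 1]` supplies a point where the bump is nonzero, so its integral
is positive. -/
theorem exists_deriv_profile_eq_one : ∃ t > 0, deriv profile t = 1 := by
  obtain ⟨t, ht, h⟩ := exists_deriv_eq_slope profile (zero_lt_one' ℝ)
    (contDiff_profile (n := 0)).continuous.continuousOn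
    ((contDiff_profile (n := 1)).differentiable (by simp)).differentiableOn
  refine ⟨t, ht.1, ?_⟩
  rw [h, profile_of_ge le_rfl, profile_of_le (by norm_num)]
  norm_num

/-- The Cauchy kernel `1 / z`, smoothed in the disc of radius `ε`. -/
noncomputable def cauchyKernel (ε : ℝ) (z : ℂ) : ℂ := profile (‖z‖ ^ 2 / ε ^ 2) * z⁻¹

/-- A smooth radial bump of radius `ε`, equal to `dbar (cauchyKernel ε)`. -/
noncomputable def bump (ε : ℝ) (z : ℂ) : ℝ := 2 * deriv profile (‖z‖ ^ 2 / ε ^ 2) / ε ^ 2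

/-- The profile vanishes below `1/2`, which removes the pole and makes the kernel smooth at the
origin. -/
theorem cauchyKernel_eventuallyEq_zero (ε : ℝ) :
    cauchyKernel ε =ᶠ[𝓝 0] fun _ => 0 := by
  have hc : ContinuousAt (fun z : ℂ => ‖z‖ ^ 2 / ε ^ 2) 0 := by fun_prop
  have : ∀ᶠ z : ℂ in 𝓝 0, ‖z‖ ^ 2 / ε ^ 2 < 1 / 2 := by
    apply hc.eventually_lt_const
    simp
  filter_upwards [this] with z hz
  simp [cauchyKernel, profile_of_le hz.le]

theorem contDiff_cauchyKernel (ε : ℝ) {n : ℕ∞} :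
    ContDiff ℝ n (cauchyKernel ε) := by
  rw [contDiff_iff_contDiffAt]
  intro z
  by_cases hz : z = 0
  · subst hz
    exact contDiffAt_const.congr_of_eventuallyEq (cauchyKernel_eventuallyEq_zero ε)
  · have h1 : ContDiff ℝ n (fun z : ℂ => ((profile (‖z‖ ^ 2 / ε ^ 2) : ℝ) : ℂ)) :=
      ofRealCLM.contDiff.comp (contDiff_profile.comp ((contDiff_norm_sq ℝ).div_const _))
    exact h1.contDiffAt.mul (contDiffAt_inv ℝ hz)

theorem contDiff_bump (ε : ℝ) {n : ℕ∞} : ContDiff ℝ n (bump ε) :=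
  (contDiff_const.mul (contDiff_deriv_profile.comp ((contDiff_norm_sq ℝ).div_const _))).div_const _

theorem bump_nonneg (ε : ℝ) (z : ℂ) : 0 ≤ bump ε z := by
  have := deriv_profile_nonneg (‖z‖ ^ 2 / ε ^ 2)
  unfold bump
  positivity

theorem support_bump_subset {ε : ℝ} (hε : 0 < ε) :
    Function.support (bump ε) ⊆ closedBall 0 ε := by
  intro z hz
  rw [mem_closedBall_zero_iff]
  by_contra! h
  apply hz
  have : 1 < ‖z‖ ^ 2 / ε ^ 2 := by
    rw [one_lt_div (by positivity)]
    gcongr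
  simp [bump, deriv_profile_of_gt this]

theorem hasCompactSupport_bump {ε : ℝ} (hε : 0 < ε) : HasCompactSupport (bump ε) :=
  HasCompactSupport.of_support_subset_isCompact (isCompact_closedBall _ _)
    (support_bump_subset hε)

theorem cauchyKernel_of_le {ε : ℝ} (hε : 0 < ε) {z : ℂ} (h : ε ≤ ‖z‖) :
    cauchyKernel ε z = z⁻¹ := by
  have : 1 ≤ ‖z‖ ^ 2 / ε ^ 2 := by
    rw [one_le_div (by positivity)]
    gcongr
  simp [cauchyKernel, profile_of_ge this]

/-- Away from `0` the factor `1/z` is holomorphic, so `dbar` only acts on the profile; `dbar ‖z‖² =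
2z` then cancels `1/z`. -/
theorem dbar_cauchyKernel {ε : ℝ} (hε : 0 < ε) (z : ℂ) :
    dbar (cauchyKernel ε) z = bump ε z := by
  by_cases hz : z = 0
  · subst hz
    rw [dbar_congr (cauchyKernel_eventuallyEq_zero ε)]
    simp [dbar, bump, deriv_profile_of_lt]
  · have hp : HasDerivAt profile (deriv profile (‖z‖ ^ 2 / ε ^ 2)) (‖z‖ ^ 2 / ε ^ 2) :=
      ((contDiff_profile (n := 1)).differentiable (by simp) _).hasDerivAt
    have hn : HasFDerivAt (fun z : ℂ => ‖z‖ ^ 2 / ε ^ 2) ((ε ^ 2)⁻¹ • (2 • innerSL ℝ z)) z := by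
      simpa [div_eq_inv_mul] using
        ((hasStrictFDerivAt_norm_sq z).hasFDerivAt.const_mul ((ε ^ 2)⁻¹))
    have h1 := ofRealCLM.hasFDerivAt.comp z (hp.comp_hasFDerivAt z hn)
    have h2 : HasFDerivAt (fun z : ℂ => z⁻¹) _ z :=
      (hasDerivAt_inv hz).hasFDerivAt.restrictScalars ℝ
    have h3 : HasFDerivAt (cauchyKernel ε) _ z := h1.mul h2
    simp only [dbar, h3.fderiv, bump]
    have e : (z.re : ℂ) + I * z.im = z := by rw [mul_comm]; exact re_add_im z
    have hε' : (ε : ℂ) ≠ 0 := ofReal_ne_zero.2 hε.ne'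
    simp
    field_simp
    linear_combination (2 * ((deriv profile (‖z‖ ^ 2 / ε ^ 2) : ℝ) : ℂ)) * z * e -
      ((profile (‖z‖ ^ 2 / ε ^ 2) : ℝ) : ℂ) * ε ^ 2 * I_sq

theorem integrable_fderiv_apply {F : Type*} [NormedAddCommGroup F] [NormedSpace ℝ F]
    {f : ℂ → F} (hf : ContDiff ℝ 1 f) (hc : HasCompactSupport f) (v : ℂ) :
    Integrable (fun x => fderiv ℝ f x v) :=
  Continuous.integrable_of_hasCompactSupport
    ((hf.continuous_fderiv one_ne_zero).clm_apply continuous_const) (hc.fderiv_apply ℝ v)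

theorem integral_fderiv_eq_zero {F : Type*} [NormedAddCommGroup F] [NormedSpace ℝ F]
    {f : ℂ → F} (hf : ContDiff ℝ 1 f) (hc : HasCompactSupport f) (v : ℂ) :
    ∫ x, fderiv ℝ f x v = 0 := by
  have := integral_smul_fderiv_eq_neg_fderiv_smul_of_integrable (μ := volume) (𝕜 := ℝ)
    (f := fun _ : ℂ => (1 : ℝ)) (g := f) (v := v) (by simp)
    (by simpa using integrable_fderiv_apply hf hc v)
    (by simpa using hf.continuous.integrable_of_hasCompactSupport hc)
    (fun _ _ => differentiableAt_const _) (fun x _ => hf.differentiable one_ne_zero x)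
  simpa using this

theorem integral_dbar_eq_zero {f : ℂ → ℂ} (hf : ContDiff ℝ 1 f) (hc : HasCompactSupport f) :
    ∫ x, dbar f x = 0 := by
  simp only [dbar]
  rw [integral_add (integrable_fderiv_apply hf hc 1)
      ((integrable_fderiv_apply hf hc I).const_mul I),
    integral_const_mul, integral_fderiv_eq_zero hf hc, integral_fderiv_eq_zero hf hc]
  simp

theorem cauchyKernel_sub_eq_zero {ε δ : ℝ} (hε : 0 < ε) (hδ : 0 < δ) {z : ℂ}
    (hz : z ∉ closedBall (0 : ℂ) (max ε δ)) : cauchyKernel ε z - cauchyKernel δ z = 0 := by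
  rw [mem_closedBall_zero_iff, not_le] at hz
  rw [cauchyKernel_of_le hε ((le_max_left _ _).trans hz.le),
    cauchyKernel_of_le hδ ((le_max_right _ _).trans hz.le), sub_self]

theorem hasCompactSupport_cauchyKernel_sub {ε δ : ℝ} (hε : 0 < ε) (hδ : 0 < δ) :
    HasCompactSupport (fun z => cauchyKernel ε z - cauchyKernel δ z) :=
  HasCompactSupport.intro (isCompact_closedBall 0 (max ε δ))
    fun _ => cauchyKernel_sub_eq_zero hε hδ

theorem dbar_cauchyKernel_sub {ε δ : ℝ} (hε : 0 < ε) (hδ : 0 < δ) (z : ℂ) :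
    dbar (fun z => cauchyKernel ε z - cauchyKernel δ z) z = bump ε z - bump δ z := by
  rw [dbar_sub ((contDiff_cauchyKernel ε (n := 1)).differentiable (by simp) z)
    ((contDiff_cauchyKernel δ (n := 1)).differentiable (by simp) z),
    dbar_cauchyKernel hε, dbar_cauchyKernel hδ]

theorem integrable_bump {ε : ℝ} (hε : 0 < ε) : Integrable (bump ε) :=
  (contDiff_bump ε (n := 0)).continuous.integrable_of_hasCompactSupport (hasCompactSupport_bump hε)

/-- Two kernels agree outside a disc, so the difference of the bumps is `dbar` of a compactly
supported function and integrates to zero. -/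
theorem integral_bump_eq {ε δ : ℝ} (hε : 0 < ε) (hδ : 0 < δ) :
    ∫ z, bump ε z = ∫ z, bump δ z := by
  have h := integral_dbar_eq_zero
    (((contDiff_cauchyKernel ε (n := 1))).sub (contDiff_cauchyKernel δ (n := 1)))
    (hasCompactSupport_cauchyKernel_sub hε hδ)
  simp only [dbar_cauchyKernel_sub hε hδ] at h
  rw [integral_sub (integrable_bump hε).ofReal (integrable_bump hδ).ofReal, sub_eq_zero,
    integral_complex_ofReal, integral_complex_ofReal] at h
  exact_mod_cast h

theorem integral_bump_pos {ε : ℝ} (hε : 0 < ε) : 0 < ∫ z, bump ε z := by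
  rw [integral_bump_eq hε one_pos]
  obtain ⟨t, ht, h⟩ := exists_deriv_profile_eq_one
  refine (contDiff_bump 1 (n := 0)).continuous.integral_pos_of_hasCompactSupport_nonneg_nonzero
    (x := (Real.sqrt t : ℂ)) (hasCompactSupport_bump one_pos) (bump_nonneg 1) ?_
  simp [bump, Real.sq_sqrt ht.le, h]

/-- Domination by a multiple of the inverse area of the disc is what makes the bumps an approximate
identity at Lebesgue points. -/
theorem exists_bump_le : ∃ M, ∀ ε > 0, ∀ z, bump ε z ≤ M / volume.real (closedBall (0 : ℂ) ε) := by
  obtain ⟨M, hM⟩ := exists_deriv_profile_le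
  refine ⟨2 * M * Real.pi, fun ε hε z => ?_⟩
  have : volume.real (closedBall (0 : ℂ) ε) = Real.pi * ε ^ 2 := by
    simp [Measure.real, Complex.volume_closedBall, hε.le, mul_comm]
  rw [this, bump, mul_comm (2 * M) Real.pi, mul_div_mul_left _ _ Real.pi_ne_zero]
  gcongr
  exact hM _

/-! ### Mollification -/

/-- The (unnormalized) mollification of `f` at scale `ε`. -/
noncomputable def mollify (ε : ℝ) (f : ℂ → ℂ) (z : ℂ) : ℂ := ∫ t, bump ε (z - t) • f t

/-- Lebesgue differentiation: at almost every `z` the averages of `‖f - f z‖` over shrinking discs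
tend to zero. -/
theorem mollify_tendsto {f : ℂ → ℂ} (hf : Integrable f) :
    ∀ᵐ z, Tendsto (fun n : ℕ => mollify (1 / ((n : ℝ) + 1)) f z) atTop
      (𝓝 ((∫ t, bump 1 t) • f z)) := by
  obtain ⟨M, hM⟩ := exists_bump_le
  set c := ∫ t, bump 1 t with hc_def
  have hc : 0 < c := integral_bump_pos one_pos
  filter_upwards [(Besicovitch.vitaliFamily (volume : Measure ℂ)).ae_tendsto_average_norm_sub
    hf.locallyIntegrable] with z h
  have hpos : ∀ n : ℕ, 0 < 1 / ((n : ℝ) + 1) := fun n => by positivity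
  have hφ : Tendsto (fun n : ℕ => 1 / ((n : ℝ) + 1)) atTop (𝓝[>] 0) :=
    tendsto_nhdsWithin_iff.2 ⟨tendsto_one_div_add_atTop_nhds_zero_nat,
      Eventually.of_forall hpos⟩
  have h1 := (h.comp (Besicovitch.tendsto_filterAt volume z)).comp hφ
  have key : Tendsto (fun n : ℕ => ∫ t, (c⁻¹ * bump (1 / ((n : ℝ) + 1)) (z - t)) • f t) atTop
      (𝓝 (f z)) := by
    refine tendsto_integral_smul_of_tendsto_average_norm_sub (c⁻¹ * M) h1 ?_ ?_ ?_ ?_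
    · exact Eventually.of_forall fun n => hf.integrableOn
    · refine tendsto_const_nhds.congr fun n => ?_
      rw [integral_const_mul, integral_sub_left_eq_self (bump _), integral_bump_eq (hpos n) one_pos,
        inv_mul_cancel₀ hc.ne']
    · refine Eventually.of_forall fun n t ht => ?_
      have : bump (1 / ((n : ℝ) + 1)) (z - t) ≠ 0 := right_ne_zero_of_mul ht
      have := support_bump_subset (hpos n) this
      rwa [mem_closedBall_zero_iff, ← dist_eq_norm, dist_comm] at this
    · refine Eventually.of_forall fun n t => ?_
      have hn := bump_nonneg (1 / ((n : ℝ) + 1)) (z - t)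
      have : volume.real (closedBall z (1 / ((n : ℝ) + 1))) =
          volume.real (closedBall (0 : ℂ) (1 / ((n : ℝ) + 1))) := by
        simp [Measure.real, Complex.volume_closedBall]
      rw [abs_of_nonneg (mul_nonneg (inv_nonneg.2 hc.le) hn), this, mul_div_assoc]
      exact mul_le_mul_of_nonneg_left (hM _ (hpos n) _) (inv_nonneg.2 hc.le)
  refine (key.const_smul c).congr fun n => ?_
  rw [mollify, ← integral_smul]
  congr 1 with t
  rw [smul_smul, mul_inv_cancel_left₀ hc.ne']

theorem hasFDerivAt_mollify {ε : ℝ} (hε : 0 < ε) {f : ℂ → ℂ} (hf : Integrable f) (z : ℂ) :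
    ∃ D : ℂ →L[ℝ] ℂ, HasFDerivAt (mollify ε f) D z ∧
      ∀ v, D v = ∫ t, fderiv ℝ (bump ε) (z - t) v • f t := by
  have h := (hasCompactSupport_bump hε).hasFDerivAt_convolution_right
    ((ContinuousLinearMap.lsmul ℝ ℝ : ℝ →L[ℝ] ℂ →L[ℝ] ℂ).flip) (μ := volume)
    hf.locallyIntegrable (contDiff_bump ε) z
  refine ⟨_, h, fun v => ?_⟩
  rw [convolution_precompR_apply _ hf.locallyIntegrable ((hasCompactSupport_bump hε).fderiv ℝ)
    ((contDiff_bump ε (n := 1)).continuous_fderiv (by simp))]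
  rfl

/-! ### Weyl's lemma -/

/-- `w` satisfies the Cauchy-Riemann equations on `Ω` in the sense of distributions. -/
def IsWeaklyHolomorphic (Ω : Opens ℂ) (w : ℂ → ℂ) : Prop :=
  ∀ φ : 𝓓(Ω, ℝ), ∫ x in (Ω : Set ℂ), dbar (fun x => (φ x : ℂ)) x * w x = 0

/-- The definition only tests with real functions, while the Cauchy kernel is complex; split `ψ`
into real and imaginary parts. -/
theorem IsWeaklyHolomorphic.integral_dbar_mul {Ω : Opens ℂ} {w : ℂ → ℂ}
    (h : IsWeaklyHolomorphic Ω w) (hw : IntegrableOn w Ω) {ψ : ℂ → ℂ}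
    (hψ : ContDiff ℝ (⊤ : ℕ∞) ψ) (hc : HasCompactSupport ψ) (hs : tsupport ψ ⊆ Ω) :
    ∫ x in (Ω : Set ℂ), dbar ψ x * w x = 0 := by
  have hint : ∀ {g : ℂ → ℂ}, ContDiff ℝ (⊤ : ℕ∞) g → HasCompactSupport g →
      IntegrableOn (fun x => dbar g x * w x) Ω := by
    intro g hg hgc
    have hcont := continuous_dbar (hg.of_le (by exact_mod_cast le_top))
    have hsupp : HasCompactSupport (dbar g) := by
      refine hgc.mono' fun x hx => ?_
      by_contra hx'
      apply hx
      rw [dbar_congr (notMem_tsupport_iff_eventuallyEq.1 hx')]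
      simp [dbar]
    obtain ⟨B, hB⟩ := hcont.bounded_above_of_compact_support hsupp
    exact hw.bdd_mul hcont.aestronglyMeasurable (Eventually.of_forall hB)
  have hr : ContDiff ℝ (⊤ : ℕ∞) (fun x => (ψ x).re) := reCLM.contDiff.comp hψ
  have hi : ContDiff ℝ (⊤ : ℕ∞) (fun x => (ψ x).im) := imCLM.contDiff.comp hψ
  have hrs : tsupport (fun x => (ψ x).re) ⊆ tsupport ψ :=
    closure_mono fun x hx h0 => hx (by simp [h0])
  have his : tsupport (fun x => (ψ x).im) ⊆ tsupport ψ :=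
    closure_mono fun x hx h0 => hx (by simp [h0])
  have hrc : HasCompactSupport (fun x => (ψ x).re) := hc.comp_left (g := re) rfl
  have hic : HasCompactSupport (fun x => (ψ x).im) := hc.comp_left (g := im) rfl
  have h1 : ∫ x in (Ω : Set ℂ), dbar (fun x => ((ψ x).re : ℂ)) x * w x = 0 :=
    h ⟨_, hr, hrc, hrs.trans hs⟩
  have h2 : ∫ x in (Ω : Set ℂ), dbar (fun x => ((ψ x).im : ℂ)) x * w x = 0 :=
    h ⟨_, hi, hic, his.trans hs⟩
  have key : ∀ x, dbar ψ x * w x = dbar (fun x => ((ψ x).re : ℂ)) x * w x +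
      I * (dbar (fun x => ((ψ x).im : ℂ)) x * w x) := by
    intro x
    have hd := (hψ.differentiable (by simp) x).hasFDerivAt
    have e1 : HasFDerivAt (fun x => (ψ x).re) (reCLM.comp (fderiv ℝ ψ x)) x :=
      reCLM.hasFDerivAt.comp x hd
    have e2 : HasFDerivAt (fun x => (ψ x).im) (imCLM.comp (fderiv ℝ ψ x)) x :=
      imCLM.hasFDerivAt.comp x hd
    rw [dbar_ofReal e1.differentiableAt, dbar_ofReal e2.differentiableAt, e1.fderiv, e2.fderiv]
    have r1 := re_add_im (fderiv ℝ ψ x 1)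
    have r2 := re_add_im (fderiv ℝ ψ x I)
    simp only [dbar, ContinuousLinearMap.comp_apply, reCLM_apply, imCLM_apply]
    linear_combination -w x * r1 - w x * I * r2
  simp only [key]
  have i1 : IntegrableOn (fun x => dbar (fun x => ((ψ x).re : ℂ)) x * w x) Ω :=
    hint (ofRealCLM.contDiff.comp hr) (hrc.comp_left (g := ofReal) rfl)
  have i2 : IntegrableOn (fun x => dbar (fun x => ((ψ x).im : ℂ)) x * w x) Ω :=
    hint (ofRealCLM.contDiff.comp hi) (hic.comp_left (g := ofReal) rfl)
  rw [integral_add i1 (i2.const_mul I), integral_const_mul, h1, h2]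
  simp

theorem tsupport_comp_const_sub_subset {F : Type*} [Zero F] {ψ : ℂ → F} {r : ℝ}
    (h : ∀ x ∉ closedBall (0 : ℂ) r, ψ x = 0) (z : ℂ) :
    tsupport (fun t => ψ (z - t)) ⊆ closedBall z r := by
  refine closure_minimal (fun t ht => ?_) isClosed_closedBall
  by_contra h'
  apply ht
  apply h
  rwa [mem_closedBall_zero_iff, ← dist_eq_norm, dist_comm]

theorem hasCompactSupport_comp_const_sub {F : Type*} [Zero F] {ψ : ℂ → F} {r : ℝ}
    (h : ∀ x ∉ closedBall (0 : ℂ) r, ψ x = 0) (z : ℂ) :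
    HasCompactSupport (fun t => ψ (z - t)) :=
  (isCompact_closedBall z r).of_isClosed_subset (isClosed_tsupport _)
    (tsupport_comp_const_sub_subset h z)

theorem bump_eq_zero {ε : ℝ} (hε : 0 < ε) : ∀ x ∉ closedBall (0 : ℂ) ε, bump ε x = 0 :=
  fun _ hx => by_contra fun h => hx (support_bump_subset hε h)

theorem integrable_bump_smul {ε : ℝ} (hε : 0 < ε) {f : ℂ → ℂ} (hf : Integrable f) (z : ℂ) :
    Integrable fun t => bump ε (z - t) • f t := by
  have hcont : Continuous fun t => bump ε (z - t) :=
    (contDiff_bump ε (n := 0)).continuous.comp (by fun_prop)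
  obtain ⟨B, hB⟩ := hcont.bounded_above_of_compact_support
    (hasCompactSupport_comp_const_sub (bump_eq_zero hε) z)
  exact hf.bdd_smul B hcont.aestronglyMeasurable (Eventually.of_forall hB)

section Weyl

variable {Ω : Opens ℂ} {w : ℂ → ℂ}

/-- The difference of the two bumps is `dbar` of a compactly supported difference of Cauchy kernels;
reflected and translated to `z`, that difference is a test function on `Ω`. -/
theorem IsWeaklyHolomorphic.mollify_eq (h : IsWeaklyHolomorphic Ω w) (hw : IntegrableOn w Ω)
    {ε δ : ℝ} (hε : 0 < ε) (hδ : 0 < δ) {z : ℂ} (hεz : closedBall z ε ⊆ Ω)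
    (hδz : closedBall z δ ⊆ Ω) :
    mollify ε ((Ω : Set ℂ).indicator w) z = mollify δ ((Ω : Set ℂ).indicator w) z := by
  have hf : Integrable ((Ω : Set ℂ).indicator w) :=
    (integrable_indicator_iff Ω.isOpen.measurableSet).2 hw
  have hz : closedBall z (max ε δ) ⊆ Ω := by
    rcases max_choice ε δ with h | h <;> rwa [h]
  have hcd : ContDiff ℝ (⊤ : ℕ∞) (fun z => cauchyKernel ε z - cauchyKernel δ z) :=
    (contDiff_cauchyKernel ε).sub (contDiff_cauchyKernel δ)
  have key := h.integral_dbar_mul hw (ψ := fun t => (fun z => cauchyKernel ε z -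
      cauchyKernel δ z) (z - t)) (hcd.comp (by fun_prop))
    (hasCompactSupport_comp_const_sub (fun _ => cauchyKernel_sub_eq_zero hε hδ) z)
    ((tsupport_comp_const_sub_subset (fun _ => cauchyKernel_sub_eq_zero hε hδ) z).trans hz)
  simp only [dbar_comp_const_sub (hcd.differentiable (by simp)),
    dbar_cauchyKernel_sub hε hδ] at key
  rw [← integral_indicator Ω.isOpen.measurableSet] at key
  rw [← sub_eq_zero, mollify, mollify,
    ← integral_sub (integrable_bump_smul hε hf z) (integrable_bump_smul hδ hf z),
    -- The reflection `t ↦ z - t` reverses the sign of `dbar`.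
    ← neg_eq_zero, ← integral_neg, ← key]
  congr 1 with t
  by_cases ht : t ∈ (Ω : Set ℂ)
  · simp [ht]
    ring
  · simp [ht]

/-- All derivatives fall on the bump, and testing weak holomorphy with `t ↦ bump ε (z - t)` gives
the Cauchy-Riemann equation at `z`. -/
theorem IsWeaklyHolomorphic.differentiableAt_mollify (h : IsWeaklyHolomorphic Ω w)
    (hw : IntegrableOn w Ω) {ε : ℝ} (hε : 0 < ε) {z : ℂ} (hz : closedBall z ε ⊆ Ω) :
    DifferentiableAt ℂ (mollify ε ((Ω : Set ℂ).indicator w)) z := by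
  have hf : Integrable ((Ω : Set ℂ).indicator w) :=
    (integrable_indicator_iff Ω.isOpen.measurableSet).2 hw
  obtain ⟨D, hD, hDv⟩ := hasFDerivAt_mollify hε hf z
  have hcd : ContDiff ℝ (⊤ : ℕ∞) (bump ε) := contDiff_bump ε
  have hcd' : ContDiff ℝ (⊤ : ℕ∞) (fun t => bump ε (z - t)) := hcd.comp (by fun_prop)
  have hcs := hasCompactSupport_comp_const_sub (bump_eq_zero hε) z
  have key := h ⟨fun t => bump ε (z - t), hcd', hcs,
    (tsupport_comp_const_sub_subset (bump_eq_zero hε) z).trans hz⟩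
  have hint : ∀ v, Integrable fun t => fderiv ℝ (bump ε) (z - t) v •
      (Ω : Set ℂ).indicator w t := by
    intro v
    have hcont : Continuous fun t => fderiv ℝ (fun t => bump ε (z - t)) t v :=
      (hcd'.continuous_fderiv (by simp)).clm_apply continuous_const
    obtain ⟨B, hB⟩ := hcont.bounded_above_of_compact_support (hcs.fderiv_apply ℝ v)
    have := (hf.bdd_smul (φ := fun t => fderiv ℝ (fun t => bump ε (z - t)) t v) B
      hcont.aestronglyMeasurable (Eventually.of_forall hB)).neg
    refine this.congr (Eventually.of_forall fun t => ?_)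
    simp [fderiv_comp_const_sub (hcd.differentiable (by simp))]
  have hsum : D 1 + I * D I = 0 := by
    rw [hDv, hDv, ← integral_const_mul, ← integral_add (hint 1) ((hint I).const_mul I),
      ← neg_eq_zero, ← integral_neg, ← key, ← integral_indicator Ω.isOpen.measurableSet]
    congr 1 with t
    by_cases ht : t ∈ (Ω : Set ℂ)
    · rw [Set.indicator_of_mem ht, Set.indicator_of_mem ht]
      change _ = dbar (fun t => ((bump ε (z - t) : ℝ) : ℂ)) t * w t
      rw [dbar_ofReal (hcd'.differentiable (by simp) t),
        fderiv_comp_const_sub (hcd.differentiable (by simp))]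
      simp
      ring
    · simp [ht]
  refine differentiableAt_complex_iff_differentiableAt_real.2 ⟨hD.differentiableAt, ?_⟩
  rw [hD.fderiv, smul_eq_mul]
  linear_combination (-I) * hsum + D I * I_sq

/-- **Weyl's lemma** for the Cauchy-Riemann equations. -/
theorem IsWeaklyHolomorphic.exists_differentiableOn (h : IsWeaklyHolomorphic Ω w)
    (hw : IntegrableOn w Ω) :
    ∃ W : ℂ → ℂ, DifferentiableOn ℂ W Ω ∧ W =ᵐ[volume.restrict (Ω : Set ℂ)] w := by
  have hf : Integrable ((Ω : Set ℂ).indicator w) :=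
    (integrable_indicator_iff Ω.isOpen.measurableSet).2 hw
  -- The factor `2` leaves room: for `x` within `ε` of `z`, the disc of radius `ε` about `x` still
  -- lies in `Ω`, so one fixed scale serves near `z`.
  have hex : ∀ z ∈ (Ω : Set ℂ), ∃ ε > 0, closedBall z (2 * ε) ⊆ Ω := by
    intro z hz
    obtain ⟨ε, hε, hb⟩ := nhds_basis_closedBall.mem_iff.1 (Ω.isOpen.mem_nhds hz)
    exact ⟨ε / 2, by positivity, by rwa [mul_div_cancel₀ _ two_ne_zero]⟩
  choose! e he hball using hex
  set c := ∫ t, bump 1 t with hc_def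
  have hc : 0 < c := integral_bump_pos one_pos
  have hball' : ∀ z ∈ (Ω : Set ℂ), closedBall z (e z) ⊆ Ω := fun z hz =>
    (closedBall_subset_closedBall (by linarith [he z hz])).trans (hball z hz)
  refine ⟨fun z => c⁻¹ • mollify (e z) ((Ω : Set ℂ).indicator w) z, ?_, ?_⟩
  · intro z hz
    have hloc : (fun x => c⁻¹ • mollify (e x) ((Ω : Set ℂ).indicator w) x) =ᶠ[𝓝 z]
        fun x => c⁻¹ • mollify (e z) ((Ω : Set ℂ).indicator w) x := by
      filter_upwards [Ω.isOpen.mem_nhds hz, ball_mem_nhds z (he z hz)] with x hx hxz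
      rw [h.mollify_eq hw (he x hx) (he z hz) (hball' x hx)]
      refine (closedBall_subset_closedBall' ?_).trans (hball z hz)
      linarith [mem_ball.1 hxz]
    refine (DifferentiableAt.congr_of_eventuallyEq ?_ hloc).differentiableWithinAt
    exact (h.differentiableAt_mollify hw (he z hz) (hball' z hz)).const_smul c⁻¹
  · filter_upwards [ae_restrict_of_ae (mollify_tendsto hf),
      ae_restrict_mem Ω.isOpen.measurableSet] with z hz hzΩ
    have hev : ∀ᶠ n : ℕ in atTop, mollify (1 / ((n : ℝ) + 1)) ((Ω : Set ℂ).indicator w) z =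
        mollify (e z) ((Ω : Set ℂ).indicator w) z := by
      filter_upwards [tendsto_one_div_add_atTop_nhds_zero_nat.eventually_lt_const (he z hzΩ)]
        with n hn
      exact h.mollify_eq hw (by positivity) (he z hzΩ)
        ((closedBall_subset_closedBall hn.le).trans (hball' z hzΩ)) (hball' z hzΩ)
    have := tendsto_nhds_unique (tendsto_const_nhds.congr' (hev.mono fun _ h => h.symm)) hz
    simp only [this, Set.indicator_of_mem hzΩ, smul_smul, ← hc_def, inv_mul_cancel₀ hc.ne',
      one_smul]

end Weyl

/-! ### Test functions and `H¹₀(Ω)` as a closed subspace -/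

theorem dir_zero : dir 0 = 1 := rfl

theorem dir_one : dir 1 = I := rfl

section TestFunctions

variable {Ω : Opens ℂ}

theorem testFunction_contDiff (φ : 𝓓(Ω, ℝ)) {n : ℕ∞} : ContDiff ℝ n φ :=
  φ.contDiff.of_le (by exact_mod_cast le_top)

theorem memLp_testFunction (φ : 𝓓(Ω, ℝ)) : MemLp φ 2 (volume.restrict (Ω : Set ℂ)) :=
  (φ.continuous.memLp_of_hasCompactSupport φ.hasCompactSupport).restrict _

theorem continuous_fderiv_testFunction (φ : 𝓓(Ω, ℝ)) (v : ℂ) :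
    Continuous fun x => fderiv ℝ φ x v :=
  ((testFunction_contDiff φ (n := 1)).continuous_fderiv (by simp)).clm_apply continuous_const

theorem memLp_fderiv_testFunction (φ : 𝓓(Ω, ℝ)) (v : ℂ) :
    MemLp (fun x => fderiv ℝ φ x v) 2 (volume.restrict (Ω : Set ℂ)) :=
  ((continuous_fderiv_testFunction φ v).memLp_of_hasCompactSupport
    (φ.hasCompactSupport.fderiv_apply ℝ v)).restrict _

/-- The class of `(φ, grad φ)` in `Jet Ω`. -/
noncomputable def jetOf (φ : 𝓓(Ω, ℝ)) : Jet Ω :=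
  WithLp.toLp 2 ((memLp_testFunction φ).toLp φ,
    WithLp.toLp 2 fun j => (memLp_fderiv_testFunction φ (dir j)).toLp _)

theorem jetOf_fst (φ : 𝓓(Ω, ℝ)) : (jetOf φ).fst = (memLp_testFunction φ).toLp φ := rfl

theorem jetOf_snd (φ : 𝓓(Ω, ℝ)) (j : Fin 2) :
    (jetOf φ).snd j = (memLp_fderiv_testFunction φ (dir j)).toLp _ := rfl

theorem mem_testJets_iff {U : Jet Ω} : U ∈ testJets Ω ↔ ∃ φ : 𝓓(Ω, ℝ), jetOf φ = U := by
  constructor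
  · rintro ⟨φ, h1, h2⟩
    refine ⟨φ, ?_⟩
    apply (WithLp.equiv 2 _).injective
    refine Prod.ext ?_ ?_
    · exact Lp.ext ((MemLp.coeFn_toLp (memLp_testFunction φ)).trans h1.symm)
    · apply (WithLp.equiv 2 _).injective
      funext j
      exact Lp.ext ((MemLp.coeFn_toLp (memLp_fderiv_testFunction φ (dir j))).trans (h2 j).symm)
  · rintro ⟨φ, rfl⟩
    exact ⟨φ, MemLp.coeFn_toLp (memLp_testFunction φ),
      fun j => MemLp.coeFn_toLp (memLp_fderiv_testFunction φ (dir j))⟩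

variable (Ω) in
/-- The map `φ ↦ (φ, grad φ)`. -/
noncomputable def jetMap : 𝓓(Ω, ℝ) →ₗ[ℝ] Jet Ω where
  toFun := jetOf
  map_add' φ ψ := by
    apply (WithLp.equiv 2 _).injective
    refine Prod.ext ?_ ?_
    · exact MemLp.toLp_add (memLp_testFunction φ) (memLp_testFunction ψ)
    · apply (WithLp.equiv 2 _).injective
      funext j
      refine Eq.trans ?_ (MemLp.toLp_add (memLp_fderiv_testFunction φ (dir j))
        (memLp_fderiv_testFunction ψ (dir j)))
      refine MemLp.toLp_congr (memLp_fderiv_testFunction (φ + ψ) (dir j)) _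
        (Eventually.of_forall fun x => ?_)
      have := fderiv_add ((testFunction_contDiff φ (n := 1)).differentiable (by simp) x)
        ((testFunction_contDiff ψ (n := 1)).differentiable (by simp) x)
      exact congrArg (fun L : ℂ →L[ℝ] ℝ => L (dir j)) this
  map_smul' c φ := by
    apply (WithLp.equiv 2 _).injective
    refine Prod.ext ?_ ?_
    · exact MemLp.toLp_const_smul c (memLp_testFunction φ)
    · apply (WithLp.equiv 2 _).injective
      funext j
      refine Eq.trans ?_ (MemLp.toLp_const_smul c (memLp_fderiv_testFunction φ (dir j)))
      refine MemLp.toLp_congr (memLp_fderiv_testFunction (c • φ) (dir j)) _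
        (Eventually.of_forall fun x => ?_)
      have := fderiv_const_smul ((testFunction_contDiff φ (n := 1)).differentiable (by simp) x) c
      exact congrArg (fun L : ℂ →L[ℝ] ℝ => L (dir j)) this

variable (Ω) in
/-- The closure of the test functions in `H¹(Ω)`, as a closed subspace of `Jet Ω`. -/
noncomputable def sobolevZero : Submodule ℝ (Jet Ω) :=
  (LinearMap.range (jetMap Ω)).topologicalClosure

theorem coe_sobolevZero : (sobolevZero Ω : Set (Jet Ω)) = closure (testJets Ω) := by
  rw [sobolevZero, Submodule.topologicalClosure_coe]
  congr 1
  ext U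
  rw [mem_testJets_iff]
  rfl

theorem jetOf_mem (φ : 𝓓(Ω, ℝ)) : jetOf φ ∈ sobolevZero Ω :=
  Submodule.le_topologicalClosure _ ⟨φ, rfl⟩

/-- A closed property of jets that holds for test functions holds on `H¹₀(Ω)`. -/
theorem sobolevZero_induction {P : Jet Ω → Prop} (hP : IsClosed {U | P U})
    (h : ∀ φ : 𝓓(Ω, ℝ), P (jetOf φ)) {U : Jet Ω} (hU : U ∈ sobolevZero Ω) : P U := by
  have : closure (testJets Ω) ⊆ {U | P U} := by
    refine closure_minimal (fun V hV => ?_) hP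
    obtain ⟨φ, rfl⟩ := mem_testJets_iff.1 hV
    exact h φ
  exact this (by rwa [← coe_sobolevZero])

variable (Ω) in
/-- The map `(u, v) ↦ vⱼ`. -/
noncomputable def partialL (j : Fin 2) : Jet Ω →L[ℝ] L2 Ω :=
  (PiLp.proj 2 (fun _ : Fin 2 => L2 Ω) j).comp (WithLp.sndL 2 ℝ _ _)

theorem continuous_snd_apply (j : Fin 2) : Continuous fun U : Jet Ω => U.snd j :=
  (partialL Ω j).continuous

theorem continuous_fst : Continuous fun U : Jet Ω => U.fst :=
  (WithLp.fstL 2 ℝ (L2 Ω) (PiLp 2 (fun _ : Fin 2 => L2 Ω))).continuous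

theorem inner_eq_integral (f g : L2 Ω) : inner ℝ f g = ∫ x in (Ω : Set ℂ), f x * g x := by
  rw [L2.inner_def]
  congr 1 with x
  simp [mul_comm]

theorem inner_toLp (f : L2 Ω) {g : ℂ → ℝ} (hg : MemLp g 2 (volume.restrict (Ω : Set ℂ))) :
    inner ℝ f (hg.toLp g) = ∫ x in (Ω : Set ℂ), f x * g x := by
  rw [inner_eq_integral]
  refine integral_congr_ae ?_
  filter_upwards [hg.coeFn_toLp] with x hx
  rw [hx]

theorem toLp_inner_toLp {f g : ℂ → ℝ} (hf : MemLp f 2 (volume.restrict (Ω : Set ℂ)))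
    (hg : MemLp g 2 (volume.restrict (Ω : Set ℂ))) :
    inner ℝ (hf.toLp f) (hg.toLp g) = ∫ x in (Ω : Set ℂ), f x * g x := by
  rw [inner_toLp]
  refine integral_congr_ae ?_
  filter_upwards [hf.coeFn_toLp] with x hx
  rw [hx]

theorem isWeakPartial_iff {j : Fin 2} {u v : L2 Ω} :
    IsWeakPartial Ω j u v ↔ ∀ φ : 𝓓(Ω, ℝ), inner ℝ u ((jetOf φ).snd j) =
      -inner ℝ v (jetOf φ).fst := by
  simp only [IsWeakPartial, jetOf_snd, jetOf_fst, inner_toLp]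

theorem eq_zero_of_notMem (φ : 𝓓(Ω, ℝ)) {x : ℂ} (hx : x ∉ (Ω : Set ℂ)) : φ x = 0 :=
  image_eq_zero_of_notMem_tsupport fun h => hx (φ.tsupport_subset h)

theorem fderiv_eq_zero_of_notMem (φ : 𝓓(Ω, ℝ)) {x : ℂ} (hx : x ∉ (Ω : Set ℂ)) :
    fderiv ℝ φ x = 0 := by
  have h : x ∉ tsupport φ := fun h => hx (φ.tsupport_subset h)
  rw [(notMem_tsupport_iff_eventuallyEq.1 h).fderiv_eq]
  simp

/-- Integration by parts for `C¹` functions one of which has compact support. -/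
theorem integral_mul_fderiv {f g : ℂ → ℝ} (hf : ContDiff ℝ 1 f) (hg : ContDiff ℝ 1 g)
    (hc : HasCompactSupport g) (v : ℂ) :
    ∫ x, f x * fderiv ℝ g x v = -∫ x, fderiv ℝ f x v * g x := by
  have hf' : Continuous fun x => fderiv ℝ f x v :=
    (hf.continuous_fderiv one_ne_zero).clm_apply continuous_const
  have hg' : Continuous fun x => fderiv ℝ g x v :=
    (hg.continuous_fderiv one_ne_zero).clm_apply continuous_const
  refine integral_mul_fderiv_eq_neg_fderiv_mul_of_integrable ?_ ?_ ?_
    (fun x _ => hf.differentiable one_ne_zero x) (fun x _ => hg.differentiable one_ne_zero x)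
  · exact (hf'.mul hg.continuous).integrable_of_hasCompactSupport hc.mul_left
  · exact (hf.continuous.mul hg').integrable_of_hasCompactSupport (hc.fderiv_apply ℝ v).mul_left
  · exact (hf.continuous.mul hg.continuous).integrable_of_hasCompactSupport hc.mul_left

theorem isWeakPartial_jetOf (φ : 𝓓(Ω, ℝ)) (j : Fin 2) :
    IsWeakPartial Ω j (jetOf φ).fst ((jetOf φ).snd j) := by
  rw [isWeakPartial_iff]
  intro ψ
  simp only [jetOf_snd, jetOf_fst, toLp_inner_toLp]
  rw [setIntegral_eq_integral_of_forall_compl_eq_zero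
      (fun x hx => by simp [eq_zero_of_notMem φ hx]),
    setIntegral_eq_integral_of_forall_compl_eq_zero
      (fun x hx => by simp [eq_zero_of_notMem ψ hx])]
  exact integral_mul_fderiv (testFunction_contDiff φ (n := 1)) (testFunction_contDiff ψ (n := 1))
    ψ.hasCompactSupport _

/-- Membership in `H1` is automatic on the closure: the weak derivative relation is a closed
condition that holds for test functions. -/
theorem mem_H10_iff {U : Jet Ω} : U ∈ H10 Ω ↔ U ∈ sobolevZero Ω := by
  constructor
  · rintro ⟨-, h⟩
    rwa [← coe_sobolevZero] at h
  · intro h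
    refine ⟨fun j => ?_, by rwa [← coe_sobolevZero]⟩
    rw [isWeakPartial_iff]
    intro ψ
    refine sobolevZero_induction (P := fun U => inner ℝ U.fst ((jetOf ψ).snd j) =
      -inner ℝ (U.snd j) (jetOf ψ).fst) (isClosed_eq ?_ ?_)
      (fun φ => isWeakPartial_iff.1 (isWeakPartial_jetOf φ j) ψ) h
    · exact continuous_fst.inner continuous_const
    · exact ((continuous_snd_apply j).inner continuous_const).neg

/-! ### Commuting derivatives, Poincaré inequality and zero means -/

/-- Moving the derivative off `φ` on both sides leaves the Hessian of `ψ`, which is symmetric. -/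
theorem integral_fderiv_mul_fderiv_comm {φ ψ : ℂ → ℝ} (hφ : ContDiff ℝ 2 φ) (hψ : ContDiff ℝ 2 ψ)
    (hc : HasCompactSupport φ) (v w : ℂ) :
    ∫ x, fderiv ℝ φ x v * fderiv ℝ ψ x w = ∫ x, fderiv ℝ φ x w * fderiv ℝ ψ x v := by
  have h : ContDiff ℝ 1 (fderiv ℝ ψ) := hψ.fderiv_right (by norm_num)
  have h' : ∀ v, ContDiff ℝ 1 fun x => fderiv ℝ ψ x v := fun v => h.clm_apply contDiff_const
  have key : ∀ v w x, fderiv ℝ (fun x => fderiv ℝ ψ x v) x w = fderiv ℝ (fderiv ℝ ψ) x w v := by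
    intro v w x
    rw [fderiv_clm_apply (h.differentiable one_ne_zero x) (by simp)]
    simp
  have hsymm : ∀ x, fderiv ℝ (fderiv ℝ ψ) x v w = fderiv ℝ (fderiv ℝ ψ) x w v := fun x =>
    (hψ.contDiffAt.isSymmSndFDerivAt (by simp)).eq v w
  have e : ∀ v w, ∫ x, fderiv ℝ φ x v * fderiv ℝ ψ x w =
      -∫ x, fderiv ℝ (fderiv ℝ ψ) x v w * φ x := by
    intro v w
    simp only [mul_comm (fderiv ℝ φ _ v)]
    rw [integral_mul_fderiv (h' w) (hφ.of_le (by norm_num)) hc]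
    simp only [key]
  rw [e, e]
  simp only [hsymm]

theorem inner_partial_comm {U V : Jet Ω} (hU : U ∈ sobolevZero Ω) (hV : V ∈ sobolevZero Ω) :
    inner ℝ (U.snd 0) (V.snd 1) = inner ℝ (U.snd 1) (V.snd 0) := by
  refine sobolevZero_induction (P := fun U => inner ℝ (U.snd 0) (V.snd 1) =
    inner ℝ (U.snd 1) (V.snd 0)) (isClosed_eq ?_ ?_) (fun φ => ?_) hU
  · exact (continuous_snd_apply 0).inner continuous_const
  · exact (continuous_snd_apply 1).inner continuous_const
  refine sobolevZero_induction (P := fun V => inner ℝ ((jetOf φ).snd 0) (V.snd 1) =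
    inner ℝ ((jetOf φ).snd 1) (V.snd 0)) (isClosed_eq ?_ ?_) (fun ψ => ?_) hV
  · exact continuous_const.inner (continuous_snd_apply 1)
  · exact continuous_const.inner (continuous_snd_apply 0)
  simp only [jetOf_snd, toLp_inner_toLp]
  rw [setIntegral_eq_integral_of_forall_compl_eq_zero
      (fun x hx => by simp [fderiv_eq_zero_of_notMem φ hx]),
    setIntegral_eq_integral_of_forall_compl_eq_zero
      (fun x hx => by simp [fderiv_eq_zero_of_notMem φ hx])]
  exact integral_fderiv_mul_fderiv_comm (testFunction_contDiff φ (n := 2))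
    (testFunction_contDiff ψ (n := 2)) φ.hasCompactSupport _ _

/-- The **Poincaré inequality** for compactly supported functions. -/
theorem integral_sq_le_of_support_subset {φ : ℂ → ℝ} (hφ : ContDiff ℝ 1 φ)
    (hc : HasCompactSupport φ) {R : ℝ} (hR : ∀ x ∈ Function.support φ, ‖x‖ ≤ R) :
    ∫ x, φ x * φ x ≤ (2 * R) ^ 2 * ∫ x, fderiv ℝ φ x 1 * fderiv ℝ φ x 1 := by
  have hd : ∀ x, fderiv ℝ (fun x => φ x * φ x) x 1 = 2 * φ x * fderiv ℝ φ x 1 := by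
    intro x
    have := (hφ.differentiable one_ne_zero x).hasFDerivAt
    rw [(this.fun_mul this).fderiv]
    simp
    ring
  have hcont : Continuous fun x => fderiv ℝ φ x 1 :=
    (hφ.continuous_fderiv one_ne_zero).clm_apply continuous_const
  -- Since `∂₀ re = 1`, integrating by parts gives `∫ φ² = -∫ 2 x₀ φ ∂₀φ`.
  have hibp := integral_mul_fderiv (f := re) reCLM.contDiff (hφ.mul hφ) (hc.mul_left (f := φ)) 1
  have hone : ∀ x, fderiv ℝ re x 1 = 1 := by
    intro x
    have : HasFDerivAt re reCLM x := reCLM.hasFDerivAt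
    rw [this.fderiv]
    simp
  simp only [hd, hone, one_mul] at hibp
  have i1 : Integrable fun x => φ x * φ x :=
    (hφ.continuous.mul hφ.continuous).integrable_of_hasCompactSupport hc.mul_left
  have i2 : Integrable fun x => fderiv ℝ φ x 1 * fderiv ℝ φ x 1 :=
    (hcont.mul hcont).integrable_of_hasCompactSupport (hc.fderiv_apply ℝ 1).mul_left
  have i3 : Integrable fun x => x.re * (2 * φ x * fderiv ℝ φ x 1) :=
    (continuous_re.mul ((continuous_const.mul hφ.continuous).mul
      hcont)).integrable_of_hasCompactSupport (hc.fderiv_apply ℝ 1).mul_left.mul_left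
  have hle : ∫ x, -(x.re * (2 * φ x * fderiv ℝ φ x 1)) ≤
      ∫ x, ((1 / 2) * (φ x * φ x) + 2 * R ^ 2 * (fderiv ℝ φ x 1 * fderiv ℝ φ x 1)) := by
    refine integral_mono i3.neg ((i1.const_mul _).add (i2.const_mul _)) fun x => ?_
    -- The bound by `R` is only known on the support. There, Young's inequality with weight `1/2`
    -- lets `½ ∫ φ²` be absorbed, which produces `4R²`.
    by_cases hx : φ x = 0
    · simp only [hx, mul_zero, zero_mul, neg_zero, zero_add]
      exact mul_nonneg (by positivity) (mul_self_nonneg _)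
    · have h1 : |x.re| ≤ R := (abs_re_le_norm x).trans (hR x hx)
      have h2 : x.re ^ 2 ≤ R ^ 2 := by
        rw [← sq_abs]
        gcongr
      have h3 := mul_le_mul_of_nonneg_right h2 (sq_nonneg (fderiv ℝ φ x 1))
      nlinarith [sq_nonneg (φ x + 2 * x.re * fderiv ℝ φ x 1)]
  rw [integral_neg, integral_add (i1.const_mul _) (i2.const_mul _), integral_const_mul,
    integral_const_mul, hibp] at hle
  linarith

theorem norm_fst_sq_le {R : ℝ} (hR : ∀ x ∈ (Ω : Set ℂ), ‖x‖ ≤ R) {U : Jet Ω}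
    (hU : U ∈ sobolevZero Ω) : ‖U.fst‖ ^ 2 ≤ (2 * R) ^ 2 * ‖U.snd 0‖ ^ 2 := by
  refine sobolevZero_induction (P := fun U => ‖U.fst‖ ^ 2 ≤ (2 * R) ^ 2 * ‖U.snd 0‖ ^ 2)
    (isClosed_le ?_ ?_) (fun φ => ?_) hU
  · exact continuous_fst.norm.pow 2
  · exact continuous_const.mul ((continuous_snd_apply 0).norm.pow 2)
  simp only [← real_inner_self_eq_norm_sq, jetOf_snd, jetOf_fst, toLp_inner_toLp]
  rw [setIntegral_eq_integral_of_forall_compl_eq_zero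
      (fun x hx => by simp [eq_zero_of_notMem φ hx]),
    setIntegral_eq_integral_of_forall_compl_eq_zero
      (fun x hx => by simp [fderiv_eq_zero_of_notMem φ hx])]
  exact integral_sq_le_of_support_subset (testFunction_contDiff φ (n := 1)) φ.hasCompactSupport
    fun x hx => hR x (φ.tsupport_subset (subset_tsupport _ hx))

/-- The mean is the inner product with the constant `1`, hence continuous, and it vanishes on
derivatives of test functions. -/
theorem integral_snd_eq_zero [IsFiniteMeasure (volume.restrict (Ω : Set ℂ))] {U : Jet Ω}
    (hU : U ∈ sobolevZero Ω) (j : Fin 2) : ∫ x in (Ω : Set ℂ), U.snd j x = 0 := by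
  have h : ∀ q : L2 Ω, inner ℝ ((memLp_const (1 : ℝ)).toLp (fun _ => (1 : ℝ)) : L2 Ω) q =
      ∫ x in (Ω : Set ℂ), q x := by
    intro q
    rw [real_inner_comm, inner_toLp]
    simp
  rw [← h]
  refine sobolevZero_induction (P := fun U => inner ℝ
    ((memLp_const (1 : ℝ)).toLp (fun _ => (1 : ℝ)) : L2 Ω) (U.snd j) = 0)
    (isClosed_eq (continuous_const.inner (continuous_snd_apply j)) continuous_const)
    (fun φ => ?_) hU
  rw [jetOf_snd, toLp_inner_toLp, setIntegral_eq_integral_of_forall_compl_eq_zero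
      (fun x hx => by simp [fderiv_eq_zero_of_notMem φ hx])]
  simpa using integral_fderiv_eq_zero (testFunction_contDiff φ (n := 1)) φ.hasCompactSupport _

end TestFunctions

/-! ### Surjectivity by duality -/

/-- If the adjoint of `B` is bounded below for the norm defined by a coercive form `a`, then `B` is
surjective, with a right inverse bounded by the same constant. -/
theorem exists_eq_of_dual_bound {X Y : Type*} [NormedAddCommGroup X] [InnerProductSpace ℝ X]
    [CompleteSpace X] [NormedAddCommGroup Y] [InnerProductSpace ℝ Y] [CompleteSpace Y]
    {a : X →L[ℝ] X →L[ℝ] ℝ} (ha : IsCoercive a) (B : X →L[ℝ] Y) {C : ℝ} (hC : 0 < C)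
    (h : ∀ p u, (∀ v, a u v = inner ℝ p (B v)) → ‖p‖ ^ 2 ≤ C * a u u) (q : Y) :
    ∃ u, B u = q ∧ a u u ≤ C * ‖q‖ ^ 2 := by
  -- Lax-Milgram for `a`: `T p` represents the functional `v ↦ ⟪p, B v⟫`.
  let T : Y →L[ℝ] X :=
    (ha.continuousLinearEquivOfBilin.symm : X →L[ℝ] X).comp (ContinuousLinearMap.adjoint B)
  have hT : ∀ p v, a (T p) v = inner ℝ p (B v) := by
    intro p v
    rw [← ha.continuousLinearEquivOfBilin_apply, ← ContinuousLinearMap.adjoint_inner_left]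
    simp [T]
  -- The Schur complement `B T`. As `⟪B T p, p⟫ = a (T p) (T p)`, the dual bound says it is coercive
  -- with constant `C⁻¹`, and Lax-Milgram applies a second time.
  let S : Y →L[ℝ] Y →L[ℝ] ℝ := (innerSL ℝ).comp (B.comp T)
  have hS : ∀ p y, S p y = inner ℝ (B (T p)) y := fun p y => rfl
  have hSp : ∀ p, S p p = a (T p) (T p) := fun p => by rw [hS, hT, real_inner_comm]
  have hScoer : IsCoercive S := by
    refine ⟨C⁻¹, inv_pos.2 hC, fun p => ?_⟩
    have := h p (T p) (hT p)
    rw [hSp, mul_assoc, ← sq, inv_mul_le_iff₀ hC]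
    exact this
  set p := hScoer.continuousLinearEquivOfBilin.symm q with hp
  have hq : B (T p) = q := by
    refine ext_inner_right ℝ fun y => ?_
    rw [← hS, ← hScoer.continuousLinearEquivOfBilin_apply, hp,
      ContinuousLinearEquiv.apply_symm_apply]
  refine ⟨T p, hq, ?_⟩
  have h1 : a (T p) (T p) = inner ℝ p q := by rw [hT, hq]
  have h2 := real_inner_le_norm p q
  have h3 := h p (T p) (hT p)
  have h0 : 0 ≤ a (T p) (T p) := by
    obtain ⟨c, hc, hac⟩ := ha
    exact le_trans (by positivity) (hac (T p))
  rw [← h1] at h2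
  rcases h0.eq_or_lt with h0 | h0
  · rw [← h0]
    positivity
  -- With `u = T p`, `a u u = ⟪p, q⟫`; Cauchy-Schwarz and the dual bound give `(a u u)² ≤ C (a u u)
  -- ‖q‖²`, and one factor cancels.
  · have h4 : a (T p) (T p) ^ 2 ≤ ‖p‖ ^ 2 * ‖q‖ ^ 2 := by
      rw [← mul_pow]
      gcongr
    nlinarith [mul_le_mul_of_nonneg_right h3 (sq_nonneg ‖q‖)]

variable {Ω : Opens ℂ}

/-! ### Holomorphic functions and conjugate pairs -/

theorem integrable_mul_of_continuousOn {f g : ℂ → ℂ} (hf : ContinuousOn f Ω) (hg : Continuous g)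
    (hc : HasCompactSupport g) (hs : tsupport g ⊆ Ω) : Integrable fun x => f x * g x := by
  have hsub : Function.support (fun x => f x * g x) ⊆ tsupport g :=
    (Function.support_mul_subset_right f g).trans (subset_tsupport g)
  rw [← integrableOn_iff_integrable_of_support_subset hsub]
  exact ((hf.mono hs).mul hg.continuousOn).integrableOn_compact hc

/-- The real derivative of `w` in direction `v` is `v w'`, so integration by parts leaves the factor
`1 + I² = 0`. -/
theorem isWeaklyHolomorphic_of_differentiableOn {w : ℂ → ℂ} (hw : DifferentiableOn ℂ w Ω) :
    IsWeaklyHolomorphic Ω w := by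
  intro φ
  set ψ : ℂ → ℂ := fun x => (φ x : ℂ) with hψ_def
  have hψ : ContDiff ℝ 1 ψ := ofRealCLM.contDiff.comp (testFunction_contDiff φ (n := 1))
  have hψc : HasCompactSupport ψ := φ.hasCompactSupport.comp_left (g := ofReal) rfl
  have hψs : tsupport ψ ⊆ Ω :=
    (closure_mono fun x (hx : ψ x ≠ 0) (h0 : φ x = 0) =>
      hx (by simp [hψ_def, h0])).trans φ.tsupport_subset
  have hψ0 : ∀ x ∉ (Ω : Set ℂ), fderiv ℝ ψ x = 0 := by
    intro x hx
    rw [(notMem_tsupport_iff_eventuallyEq.1 fun h => hx (hψs h)).fderiv_eq]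
    simp
  have hderiv : ∀ x ∈ (Ω : Set ℂ), ∀ v, fderiv ℝ w x v = v * deriv w x := by
    intro x hx v
    have := (hw.differentiableAt (Ω.isOpen.mem_nhds hx)).hasDerivAt.hasFDerivAt.restrictScalars ℝ
    rw [this.fderiv]
    simp
  have hdc : ContinuousOn (deriv w) Ω := (hw.deriv Ω.isOpen).continuousOn
  have i1 : ∀ v, Integrable fun x => w x * fderiv ℝ ψ x v := fun v =>
    integrable_mul_of_continuousOn hw.continuousOn
      ((hψ.continuous_fderiv one_ne_zero).clm_apply continuous_const)
      (hψc.fderiv_apply ℝ v) ((tsupport_fderiv_apply_subset ℝ v).trans hψs)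
  have hzero : ∀ x ∉ (Ω : Set ℂ), ψ x = 0 := fun x hx =>
    image_eq_zero_of_notMem_tsupport fun h => hx (hψs h)
  have e : ∀ v x, fderiv ℝ w x v * ψ x = v * (deriv w x * ψ x) := by
    intro v x
    by_cases hx : x ∈ (Ω : Set ℂ)
    · rw [hderiv x hx]
      ring
    · simp [hzero x hx]
  have i2 : Integrable fun x => deriv w x * ψ x :=
    integrable_mul_of_continuousOn hdc hψ.continuous hψc hψs
  have ibp : ∀ v, ∫ x, w x * fderiv ℝ ψ x v = -(v * ∫ x, deriv w x * ψ x) := by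
    intro v
    rw [integral_mul_fderiv_eq_neg_fderiv_mul_of_integrable (by simpa only [e] using i2.const_mul v)
      (i1 v) (integrable_mul_of_continuousOn hw.continuousOn hψ.continuous hψc hψs)
      (fun x hx => ((hw.differentiableAt (Ω.isOpen.mem_nhds (hψs hx))).restrictScalars ℝ))
      (fun x _ => hψ.differentiable one_ne_zero x)]
    simp only [e]
    rw [integral_const_mul]
  rw [setIntegral_eq_integral_of_forall_compl_eq_zero (fun x hx => by simp [dbar, hψ0 x hx])]
  have : ∀ x, dbar ψ x * w x = w x * fderiv ℝ ψ x 1 + I * (w x * fderiv ℝ ψ x I) := by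
    intro x
    simp only [dbar]
    ring
  simp only [this]
  rw [integral_add (i1 1) ((i1 I).const_mul I), integral_const_mul, ibp, ibp]
  linear_combination (-∫ x, deriv w x * ψ x) * I_sq

/-- `h` and `g` are conjugate harmonic functions in the sense of distributions. -/
def IsConjugate (h g : L2 Ω) : Prop :=
  ∀ φ : 𝓓(Ω, ℝ), inner ℝ h ((jetOf φ).snd 0) = inner ℝ g ((jetOf φ).snd 1) ∧
    inner ℝ h ((jetOf φ).snd 1) = -inner ℝ g ((jetOf φ).snd 0)

/-- The two conjugacy relations are the real and imaginary parts of the weak Cauchy-Riemann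
equation. -/
theorem isConjugate_iff {h g : L2 Ω} {w : ℂ → ℂ}
    (hw : w =ᵐ[volume.restrict (Ω : Set ℂ)] fun x => (h x : ℂ) + I * g x) :
    IsConjugate h g ↔ IsWeaklyHolomorphic Ω w := by
  refine forall_congr' fun φ => ?_
  have hint : ∀ (f : L2 Ω) (j : Fin 2), Integrable (fun x => f x * fderiv ℝ φ x (dir j))
      (volume.restrict (Ω : Set ℂ)) := fun f j =>
    (Lp.memLp f).integrable_mul (memLp_fderiv_testFunction φ (dir j))
  have e : ∫ x in (Ω : Set ℂ), dbar (fun x => (φ x : ℂ)) x * w x =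
      ((inner ℝ h ((jetOf φ).snd 0) - inner ℝ g ((jetOf φ).snd 1) : ℝ) : ℂ) +
        I * ((inner ℝ h ((jetOf φ).snd 1) + inner ℝ g ((jetOf φ).snd 0) : ℝ) : ℂ) := by
    simp only [jetOf_snd, inner_toLp]
    have i1 : Integrable (fun x => ((h x * fderiv ℝ φ x (dir 0) -
        g x * fderiv ℝ φ x (dir 1) : ℝ) : ℂ)) (volume.restrict (Ω : Set ℂ)) :=
      ((hint h 0).sub (hint g 1)).ofReal
    have i2 : Integrable (fun x => ((h x * fderiv ℝ φ x (dir 1) +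
        g x * fderiv ℝ φ x (dir 0) : ℝ) : ℂ)) (volume.restrict (Ω : Set ℂ)) :=
      ((hint h 1).add (hint g 0)).ofReal
    rw [← integral_sub (hint h 0) (hint g 1), ← integral_add (hint h 1) (hint g 0),
      ← integral_complex_ofReal, ← integral_complex_ofReal, ← integral_const_mul,
      ← integral_add i1 (i2.const_mul I)]
    refine integral_congr_ae ?_
    filter_upwards [hw] with x hx
    rw [hx, dbar_ofReal ((testFunction_contDiff φ (n := 1)).differentiable (by simp) x),
      dir_zero, dir_one]
    push_cast
    linear_combination (fderiv ℝ φ x I : ℂ) * g x * I_sq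
  rw [e]
  rw [Complex.ext_iff]
  simp only [add_re, ofReal_re, mul_re, I_re, I_im, ofReal_im, add_im, mul_im, zero_re, zero_im]
  constructor
  · rintro ⟨h1, h2⟩
    constructor <;> linarith
  · rintro ⟨h1, h2⟩
    constructor <;> linarith

/-! ### Divergence, curl and the Dirichlet form -/

/-- The scalar curl `∂₁ u₀ - ∂₀ u₁` of a vector field. -/
noncomputable def rot (u : Fin 2 → Jet Ω) : L2 Ω := (u 0).snd 1 - (u 1).snd 0

theorem IsConjugate.inner_div_eq {h g : L2 Ω} (hc : IsConjugate h g) {u : Fin 2 → Jet Ω}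
    (hu : ∀ k, u k ∈ sobolevZero Ω) : inner ℝ h (div u) = inner ℝ g (rot u) := by
  have h0 := sobolevZero_induction (P := fun U => inner ℝ h (U.snd 0) = inner ℝ g (U.snd 1))
    (isClosed_eq (continuous_const.inner (continuous_snd_apply 0))
      (continuous_const.inner (continuous_snd_apply 1))) (fun φ => (hc φ).1) (hu 0)
  have h1 := sobolevZero_induction (P := fun U => inner ℝ h (U.snd 1) = -inner ℝ g (U.snd 0))
    (isClosed_eq (continuous_const.inner (continuous_snd_apply 1))
      (continuous_const.inner (continuous_snd_apply 0)).neg) (fun φ => (hc φ).2) (hu 1)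
  simp only [div, rot, Fin.sum_univ_two, inner_add_right, inner_sub_right, h0, h1]
  ring

/-- The fields `(φ, 0)` and `(0, φ)` recover the two relations separately. -/
theorem isConjugate_of_inner_div_eq {h g : L2 Ω}
    (hu : ∀ u : Fin 2 → Jet Ω, (∀ k, u k ∈ sobolevZero Ω) →
      inner ℝ h (div u) = inner ℝ g (rot u)) : IsConjugate h g := by
  intro φ
  have h0 := hu ![jetOf φ, 0] (by
    intro k
    fin_cases k
    · exact jetOf_mem φ
    · exact zero_mem _)
  have h1 := hu ![0, jetOf φ] (by
    intro k
    fin_cases k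
    · exact zero_mem _
    · exact jetOf_mem φ)
  simp only [div, rot, Fin.sum_univ_two, Matrix.cons_val_zero, Matrix.cons_val_one,
    WithLp.zero_snd, PiLp.zero_apply, add_zero, zero_add, sub_zero, zero_sub,
    inner_neg_right] at h0 h1
  exact ⟨h0, h1⟩

/-- In the expanded right-hand side the mixed terms are `⟪∂₀, ∂₁⟫ - ⟪∂₁, ∂₀⟫` pairs, which cancel on
`H¹₀(Ω)`. -/
theorem sum_inner_eq {u v : Fin 2 → Jet Ω} (hu : ∀ k, u k ∈ sobolevZero Ω)
    (hv : ∀ k, v k ∈ sobolevZero Ω) :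
    ∑ k, ∑ j, inner ℝ ((u k).snd j) ((v k).snd j) =
      inner ℝ (div u) (div v) + inner ℝ (rot u) (rot v) := by
  have h1 := inner_partial_comm (hu 0) (hv 1)
  have h2 := inner_partial_comm (hu 1) (hv 0)
  simp only [div, rot, Fin.sum_univ_two, inner_add_right, inner_sub_right, inner_add_left,
    inner_sub_left]
  linarith

theorem seminormSq_eq {u : Fin 2 → Jet Ω} (hu : ∀ k, u k ∈ sobolevZero Ω) :
    seminormSq u = ‖div u‖ ^ 2 + ‖rot u‖ ^ 2 := by
  simp only [seminormSq, ← real_inner_self_eq_norm_sq]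
  exact sum_inner_eq hu hu

theorem exists_friedrichs_of_isConjugate [IsFiniteMeasure (volume.restrict (Ω : Set ℂ))]
    {h g : L2 Ω} (hc : IsConjugate h g) (hh : ∫ x in (Ω : Set ℂ), h x = 0)
    (hg : ∫ x in (Ω : Set ℂ), g x = 0) :
    ∃ w ∈ friedrichsSpace Ω, w =ᵐ[volume.restrict (Ω : Set ℂ)] fun x => (h x : ℂ) + I * g x := by
  have hmem : ∀ f : L2 Ω, MemLp (fun x => (f x : ℂ)) 2 (volume.restrict (Ω : Set ℂ)) := fun f =>
    (Lp.memLp f).ofReal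
  have hm : MemLp (fun x => (h x : ℂ) + I * g x) 2 (volume.restrict (Ω : Set ℂ)) :=
    (hmem h).add ((hmem g).const_mul I)
  have hi : ∀ f : L2 Ω, Integrable (fun x => (f x : ℂ)) (volume.restrict (Ω : Set ℂ)) := fun f =>
    (hmem f).integrable one_le_two
  obtain ⟨w, hw, hwe⟩ := ((isConjugate_iff (ae_eq_refl _)).1 hc).exists_differentiableOn
    (hm.integrable one_le_two)
  have eh : ∫ x in (Ω : Set ℂ), (h x : ℂ) = 0 :=
    integral_complex_ofReal.trans (by rw [hh, ofReal_zero])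
  have eg : ∫ x in (Ω : Set ℂ), (g x : ℂ) = 0 :=
    integral_complex_ofReal.trans (by rw [hg, ofReal_zero])
  refine ⟨w, ⟨hw, (memLp_congr_ae hwe).2 hm, ?_⟩, hwe⟩
  calc ∫ x in (Ω : Set ℂ), w x = ∫ x in (Ω : Set ℂ), ((h x : ℂ) + I * g x) :=
        integral_congr_ae hwe
    _ = (∫ x in (Ω : Set ℂ), (h x : ℂ)) + ∫ x in (Ω : Set ℂ), I * (g x : ℂ) :=
        integral_add (hi h) ((hi g).const_mul I)
    _ = 0 := by rw [eh, integral_const_mul, eg, mul_zero, add_zero]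

theorem norm_sq_eq_integral {f : L2 Ω} {g : ℂ → ℝ} (h : g =ᵐ[volume.restrict (Ω : Set ℂ)] f) :
    ‖f‖ ^ 2 = ∫ x in (Ω : Set ℂ), g x ^ 2 := by
  rw [← real_inner_self_eq_norm_sq, inner_eq_integral]
  refine integral_congr_ae ?_
  filter_upwards [h] with x hx
  rw [hx, sq]

theorem FriedrichsWith.norm_sq_le [IsFiniteMeasure (volume.restrict (Ω : Set ℂ))] {Γ : ℝ≥0}
    (hΓ : FriedrichsWith Ω Γ) {h g : L2 Ω} (hc : IsConjugate h g)
    (hh : ∫ x in (Ω : Set ℂ), h x = 0) (hg : ∫ x in (Ω : Set ℂ), g x = 0) :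
    ‖h‖ ^ 2 ≤ Γ * ‖g‖ ^ 2 := by
  obtain ⟨w, hw, hwe⟩ := exists_friedrichs_of_isConjugate hc hh hg
  have h1 : (fun x => (w x).re) =ᵐ[volume.restrict (Ω : Set ℂ)] h := by
    filter_upwards [hwe] with x hx
    simp [hx]
  have h2 : (fun x => (w x).im) =ᵐ[volume.restrict (Ω : Set ℂ)] g := by
    filter_upwards [hwe] with x hx
    simp [hx]
  rw [norm_sq_eq_integral h1, norm_sq_eq_integral h2]
  exact hΓ w hw

/-- Pairing with `u` gives `‖h‖² = ⟪g, rot u⟫`, and removing `‖div u‖² = ‖h‖²` from `|u|₁²` leaves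
`‖rot u‖² ≤ (C - 1) ‖h‖²`. -/
theorem IsConjugate.norm_sq_le {C : ℝ} (hC : 1 ≤ C) {h g : L2 Ω} (hc : IsConjugate h g)
    {u : Fin 2 → Jet Ω} (hu : ∀ k, u k ∈ sobolevZero Ω) (hdiv : div u = h)
    (hle : seminormSq u ≤ C * ‖h‖ ^ 2) : ‖h‖ ^ 2 ≤ (C - 1) * ‖g‖ ^ 2 := by
  have h1 := hc.inner_div_eq hu
  have h2 := seminormSq_eq hu
  have h3 := real_inner_le_norm g (rot u)
  rw [hdiv, real_inner_self_eq_norm_sq] at h1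
  rw [hdiv] at h2
  rw [← h1] at h3
  have h4 : ‖rot u‖ ^ 2 ≤ (C - 1) * ‖h‖ ^ 2 := by linarith
  have h5 : (‖h‖ ^ 2) ^ 2 ≤ ‖g‖ ^ 2 * ‖rot u‖ ^ 2 := by
    rw [← mul_pow]
    gcongr
  rcases (sq_nonneg ‖h‖).eq_or_lt with h0 | h0
  · rw [← h0]
    exact mul_nonneg (by linarith) (sq_nonneg _)
  · nlinarith [mul_le_mul_of_nonneg_left h4 (sq_nonneg ‖g‖)]

/-! ### From Babuška–Aziz to Friedrichs -/

/-- The witness is `∂₀φ` for a test function with `φ z = 1`; were it zero, the Poincaré inequality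
would force `φ = 0`. -/
theorem exists_integral_eq_zero_ne_zero (hne : (Ω : Set ℂ).Nonempty)
    (hbdd : Bornology.IsBounded (Ω : Set ℂ)) :
    ∃ q : L2 Ω, ∫ x in (Ω : Set ℂ), q x = 0 ∧ q ≠ 0 := by
  have : IsFiniteMeasure (volume.restrict (Ω : Set ℂ)) :=
    isFiniteMeasure_restrict.2 hbdd.measure_lt_top.ne
  obtain ⟨z, hz⟩ := hne
  obtain ⟨R, hR⟩ := hbdd.exists_norm_le
  obtain ⟨f, hfs, hfc, hf, -, hfz⟩ :=
    exists_contDiff_tsupport_subset (n := ⊤) (Ω.isOpen.mem_nhds hz)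
  let φ : 𝓓(Ω, ℝ) := ⟨f, hf, hfc, hfs⟩
  refine ⟨(jetOf φ).snd 0, integral_snd_eq_zero (jetOf_mem φ) 0, fun h0 => ?_⟩
  have h1 := norm_fst_sq_le hR (jetOf_mem φ)
  rw [h0, norm_zero, jetOf_fst, ← real_inner_self_eq_norm_sq, toLp_inner_toLp,
    setIntegral_eq_integral_of_forall_compl_eq_zero
      (fun x hx => by simp [eq_zero_of_notMem φ hx])] at h1
  have h2 := (φ.continuous.mul φ.continuous).integral_pos_of_hasCompactSupport_nonneg_nonzero
    (μ := volume) (x := z) φ.hasCompactSupport.mul_left (fun x => mul_self_nonneg (φ x))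
    (by change f z * f z ≠ 0; rw [hfz]; norm_num)
  simp only [ne_eq, OfNat.ofNat_ne_zero, not_false_eq_true, zero_pow, mul_zero] at h1
  exact absurd h2 (not_lt.2 h1)

/-- Since `|u|₁² ≥ ‖div u‖²`, a single nonzero `q` of mean zero is enough. -/
theorem BabuskaAzizWith.one_le {C : ℝ≥0} (hC : BabuskaAzizWith Ω C) (hne : (Ω : Set ℂ).Nonempty)
    (hbdd : Bornology.IsBounded (Ω : Set ℂ)) : 1 ≤ C := by
  obtain ⟨q, hq, hq0⟩ := exists_integral_eq_zero_ne_zero hne hbdd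
  obtain ⟨u, hu, hdiv, hle⟩ := hC q hq
  rw [seminormSq_eq fun k => mem_H10_iff.1 (hu k), hdiv] at hle
  have h1 : 0 < ‖q‖ ^ 2 := by positivity
  have h2 : (1 : ℝ) * ‖q‖ ^ 2 ≤ C * ‖q‖ ^ 2 := by linarith [sq_nonneg ‖rot u‖]
  exact_mod_cast le_of_mul_le_mul_right h2 h1

theorem BabuskaAzizWith.friedrichsWith (hbdd : Bornology.IsBounded (Ω : Set ℂ)) {C : ℝ≥0}
    (hC : BabuskaAzizWith Ω C) (h1 : 1 ≤ C) : FriedrichsWith Ω (C - 1) := by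
  have : IsFiniteMeasure (volume.restrict (Ω : Set ℂ)) :=
    isFiniteMeasure_restrict.2 hbdd.measure_lt_top.ne
  rintro w ⟨hw, hm, h0⟩
  set h : L2 Ω := hm.re.toLp _ with hh
  set g : L2 Ω := hm.im.toLp _ with hg
  have hhe : (fun x => (w x).re) =ᵐ[volume.restrict (Ω : Set ℂ)] h := (MemLp.coeFn_toLp hm.re).symm
  have hge : (fun x => (w x).im) =ᵐ[volume.restrict (Ω : Set ℂ)] g := (MemLp.coeFn_toLp hm.im).symm
  have hwe : w =ᵐ[volume.restrict (Ω : Set ℂ)] fun x => (h x : ℂ) + I * g x := by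
    filter_upwards [hhe, hge] with x hx hx'
    rw [← hx, ← hx', mul_comm, re_add_im]
  have hc : IsConjugate h g :=
    (isConjugate_iff hwe).2 (isWeaklyHolomorphic_of_differentiableOn hw)
  have hmean : ∫ x in (Ω : Set ℂ), h x = 0 := by
    rw [← integral_congr_ae hhe]
    simpa [h0] using reCLM.integral_comp_comm (hm.integrable one_le_two)
  obtain ⟨u, hu, hdiv, hle⟩ := hC h hmean
  rw [← norm_sq_eq_integral hhe, ← norm_sq_eq_integral hge, NNReal.coe_sub h1]
  exact hc.norm_sq_le (by exact_mod_cast h1) (fun k => mem_H10_iff.1 (hu k)) hdiv hle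

/-! ### From Friedrichs to Babuška–Aziz -/

/-- The space of vector fields with components in `H¹₀(Ω)`. -/
abbrev Fields (Ω : Opens ℂ) : Type := PiLp 2 (fun _ : Fin 2 => sobolevZero Ω)

instance : CompleteSpace (sobolevZero Ω) :=
  (Submodule.isClosed_topologicalClosure _).completeSpace_coe

noncomputable instance : InnerProductSpace ℝ (sobolevZero Ω) := Submodule.innerProductSpace _

noncomputable instance : InnerProductSpace ℝ (Fields Ω) :=
  PiLp.innerProductSpace fun _ : Fin 2 => sobolevZero Ω

instance : CompleteSpace (Fields Ω) := inferInstance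

variable (Ω) in
/-- The map `u ↦ ∂ⱼ uₖ`. -/
noncomputable def fieldPartialL (k j : Fin 2) : Fields Ω →L[ℝ] L2 Ω :=
  ((partialL Ω j).comp (sobolevZero Ω).subtypeL).comp
    (PiLp.proj 2 (fun _ : Fin 2 => sobolevZero Ω) k)

variable (Ω) in
/-- The Dirichlet form `(u, v) ↦ ∑ₖ ∑ⱼ ⟪∂ⱼ uₖ, ∂ⱼ vₖ⟫`. -/
noncomputable def dirichletForm : Fields Ω →L[ℝ] Fields Ω →L[ℝ] ℝ :=
  ∑ k, ∑ j, (innerSL ℝ : L2 Ω →L[ℝ] L2 Ω →L[ℝ] ℝ).bilinearComp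
    (fieldPartialL Ω k j) (fieldPartialL Ω k j)

theorem dirichletForm_apply (u v : Fields Ω) : dirichletForm Ω u v =
    ∑ k, ∑ j, inner ℝ ((u k : Jet Ω).snd j) ((v k : Jet Ω).snd j) := by
  simp only [dirichletForm, Fin.sum_univ_two]
  rfl

theorem dirichletForm_self (u : Fields Ω) :
    dirichletForm Ω u u = seminormSq fun k => (u k : Jet Ω) := by
  simp only [dirichletForm_apply, seminormSq, real_inner_self_eq_norm_sq]

theorem isCoercive_dirichletForm (hbdd : Bornology.IsBounded (Ω : Set ℂ)) :
    IsCoercive (dirichletForm Ω) := by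
  obtain ⟨R, hR⟩ := hbdd.exists_norm_le
  have hpos : 0 < (2 * R) ^ 2 + 1 := by positivity
  refine ⟨((2 * R) ^ 2 + 1)⁻¹, inv_pos.2 hpos, fun u => ?_⟩
  rw [dirichletForm_self, mul_assoc, ← sq, inv_mul_le_iff₀ hpos, seminormSq,
    PiLp.norm_sq_eq_of_L2, Finset.mul_sum]
  refine Finset.sum_le_sum fun k _ => ?_
  have h1 := norm_fst_sq_le hR (u k).2
  have h2 : ‖u k‖ ^ 2 = ‖(u k : Jet Ω).fst‖ ^ 2 + ∑ j, ‖(u k : Jet Ω).snd j‖ ^ 2 := by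
    rw [← PiLp.norm_sq_eq_of_L2, ← WithLp.prod_norm_sq_eq_of_L2]
    rfl
  rw [h2, Fin.sum_univ_two]
  nlinarith [mul_nonneg (sq_nonneg (2 * R)) (sq_nonneg ‖(u k : Jet Ω).snd 1‖)]

variable (Ω) in
/-- The constant function `1` in `L²(Ω)`. -/
noncomputable def oneL2 [IsFiniteMeasure (volume.restrict (Ω : Set ℂ))] : L2 Ω :=
  (memLp_const (1 : ℝ)).toLp fun _ => (1 : ℝ)

theorem mem_orthogonal_oneL2 [IsFiniteMeasure (volume.restrict (Ω : Set ℂ))] {q : L2 Ω} :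
    q ∈ (ℝ ∙ oneL2 Ω)ᗮ ↔ ∫ x in (Ω : Set ℂ), q x = 0 := by
  rw [Submodule.mem_orthogonal_singleton_iff_inner_left, oneL2, inner_toLp]
  simp

theorem integral_div_eq_zero [IsFiniteMeasure (volume.restrict (Ω : Set ℂ))] {u : Fin 2 → Jet Ω}
    (hu : ∀ k, u k ∈ sobolevZero Ω) : ∫ x in (Ω : Set ℂ), div u x = 0 :=
  mem_orthogonal_oneL2.1 (Submodule.sum_mem _ fun j _ =>
    mem_orthogonal_oneL2.2 (integral_snd_eq_zero (hu j) j))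

theorem integral_rot_eq_zero [IsFiniteMeasure (volume.restrict (Ω : Set ℂ))] {u : Fin 2 → Jet Ω}
    (hu : ∀ k, u k ∈ sobolevZero Ω) : ∫ x in (Ω : Set ℂ), rot u x = 0 :=
  mem_orthogonal_oneL2.1 (Submodule.sub_mem _
    (mem_orthogonal_oneL2.2 (integral_snd_eq_zero (hu 0) 1))
    (mem_orthogonal_oneL2.2 (integral_snd_eq_zero (hu 1) 0)))

/-- If `Δu = grad p` weakly, then `p` is controlled by the Dirichlet integral of `u`. -/
theorem FriedrichsWith.norm_sq_le_seminormSq [IsFiniteMeasure (volume.restrict (Ω : Set ℂ))]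
    {Γ : ℝ≥0} (hΓ : FriedrichsWith Ω Γ) {p : L2 Ω} (hp : ∫ x in (Ω : Set ℂ), p x = 0)
    {u : Fin 2 → Jet Ω} (hu : ∀ k, u k ∈ sobolevZero Ω)
    (hpu : ∀ v : Fin 2 → Jet Ω, (∀ k, v k ∈ sobolevZero Ω) →
      ∑ k, ∑ j, inner ℝ ((u k).snd j) ((v k).snd j) = inner ℝ p (div v)) :
    ‖p‖ ^ 2 ≤ (Γ + 1) * seminormSq u := by
  have hc : IsConjugate (p - div u) (rot u) := by
    refine isConjugate_of_inner_div_eq fun v hv => ?_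
    have h1 := hpu v hv
    rw [sum_inner_eq hu hv] at h1
    rw [inner_sub_left]
    linarith
  have hmean : ∫ x in (Ω : Set ℂ), (p - div u) x = 0 :=
    mem_orthogonal_oneL2.1 (Submodule.sub_mem _ (mem_orthogonal_oneL2.2 hp)
      (mem_orthogonal_oneL2.2 (integral_div_eq_zero hu)))
  have hF := hΓ.norm_sq_le hc hmean (integral_rot_eq_zero hu)
  -- Using `u` as its own test field gives `⟪p - div u, div u⟫ = ‖rot u‖²`.
  have hqh := hc.inner_div_eq hu
  rw [real_inner_self_eq_norm_sq] at hqh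
  have hcs := real_inner_le_norm (p - div u) (div u)
  rw [hqh] at hcs
  have hexp : ‖p‖ ^ 2 = ‖p - div u‖ ^ 2 + 2 * ‖rot u‖ ^ 2 + ‖div u‖ ^ 2 := by
    have := norm_add_sq_real (p - div u) (div u)
    rwa [sub_add_cancel, hqh] at this
  rw [seminormSq_eq hu, hexp]
  -- Cauchy-Schwarz and Friedrichs give `‖rot u‖⁴ ≤ Γ ‖rot u‖² ‖div u‖²`. Then `‖p‖² ≤ (Γ + 2) ‖rot
  -- u‖² + ‖div u‖²`, and this bound on one of the `‖rot u‖²` terms yields the factor `Γ + 1`.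
  have hg : ‖rot u‖ ^ 2 ≤ Γ * ‖div u‖ ^ 2 := by
    rcases (sq_nonneg ‖rot u‖).eq_or_lt with h0 | h0
    · rw [← h0]
      positivity
    · have h2 : (‖rot u‖ ^ 2) ^ 2 ≤ ‖p - div u‖ ^ 2 * ‖div u‖ ^ 2 := by
        rw [← mul_pow]
        gcongr
      nlinarith [mul_le_mul_of_nonneg_right hF (sq_nonneg ‖div u‖)]
  linarith

variable (Ω) in
/-- The divergence on `Fields Ω`. -/
noncomputable def fieldDivL : Fields Ω →L[ℝ] L2 Ω := ∑ j, fieldPartialL Ω j j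

theorem fieldDivL_apply (u : Fields Ω) : fieldDivL Ω u = div fun k => (u k : Jet Ω) := by
  simp only [fieldDivL, div, Fin.sum_univ_two]
  rfl

theorem FriedrichsWith.babuskaAzizWith (hbdd : Bornology.IsBounded (Ω : Set ℂ)) {Γ : ℝ≥0}
    (hΓ : FriedrichsWith Ω Γ) : BabuskaAzizWith Ω (Γ + 1) := by
  have : IsFiniteMeasure (volume.restrict (Ω : Set ℂ)) :=
    isFiniteMeasure_restrict.2 hbdd.measure_lt_top.ne
  intro q hq
  -- The target must be the mean-zero functions: the Friedrichs inequality bounds only those `p`.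
  let B : Fields Ω →L[ℝ] (ℝ ∙ oneL2 Ω)ᗮ := (fieldDivL Ω).codRestrict _ fun u => by
    rw [fieldDivL_apply]
    exact mem_orthogonal_oneL2.2 (integral_div_eq_zero fun k => (u k).2)
  have hB : ∀ u, (B u : L2 Ω) = div fun k => (u k : Jet Ω) := fieldDivL_apply
  have hpos : (0 : ℝ) < Γ + 1 := by positivity
  have hdual : ∀ (p : (ℝ ∙ oneL2 Ω)ᗮ) (u : Fields Ω),
      (∀ v, dirichletForm Ω u v = inner ℝ p (B v)) →
        ‖p‖ ^ 2 ≤ (Γ + 1) * dirichletForm Ω u u := by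
    intro p u hpu
    rw [dirichletForm_self]
    refine hΓ.norm_sq_le_seminormSq (mem_orthogonal_oneL2.1 p.2) (fun k => (u k).2)
      fun v hv => ?_
    have := hpu (WithLp.toLp 2 fun k => ⟨v k, hv k⟩)
    rw [dirichletForm_apply, Submodule.coe_inner, hB] at this
    exact this
  obtain ⟨u, hu, hle⟩ := exists_eq_of_dual_bound (isCoercive_dirichletForm hbdd) B hpos hdual
    ⟨q, mem_orthogonal_oneL2.2 hq⟩
  refine ⟨fun k => u k, fun k => mem_H10_iff.2 (u k).2, ?_, ?_⟩
  · rw [← hB, hu]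
  · rw [← dirichletForm_self]
    exact_mod_cast hle

end PlaneDomain

/-! ### Equality of the constants -/

theorem theorem1 (Ω : TopologicalSpace.Opens ℂ) (hconn : IsConnected (Ω : Set ℂ))
    (hbdd : Bornology.IsBounded (Ω : Set ℂ)) :
    (PlaneDomain.babuskaAzizConst Ω < ⊤ ↔ PlaneDomain.friedrichsConst Ω < ⊤) ∧
      PlaneDomain.babuskaAzizConst Ω = PlaneDomain.friedrichsConst Ω + 1 := by
  have key : PlaneDomain.babuskaAzizConst Ω = PlaneDomain.friedrichsConst Ω + 1 := by
    apply le_antisymm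
    · simp only [PlaneDomain.friedrichsConst, ENNReal.iInf_add]
      refine le_iInf₂ fun Γ hΓ => ?_
      exact (iInf₂_le (Γ + 1) (hΓ.babuskaAzizWith hbdd)).trans_eq (by push_cast; rfl)
    · refine le_iInf₂ fun C hC => ?_
      -- Subtraction in `ℝ≥0` is truncated, so `C - 1 + 1 = C` requires `1 ≤ C`; this is where
      -- nonemptiness of `Ω` enters.
      have h1 := hC.one_le hconn.nonempty hbdd
      refine (add_le_add_left (iInf₂_le (C - 1) (hC.friedrichsWith hbdd h1)) 1).trans_eq ?_
      rw [← ENNReal.coe_one, ← ENNReal.coe_add, tsub_add_cancel_of_le h1]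
  refine ⟨?_, key⟩
  rw [key]
  simp [ENNReal.add_lt_top]
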